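/- **Proposition 3.6.** Let $k$ be a finite field with $q$ elements, $v=\sqrt q\in\mathbb C$, and let $\mathcal A$ be a (small) $k$-linear abelian category with enough projectives, of finite global dimension, all of whose Hom- and Ext-spaces are finite dimensional over $k$. Let $\mathcal P\subset\mathcal A$ be the full subcategory of projective objects, $K(\mathcal A)$ the Grothendieck group, $\hat M$ the class of $M$ in $K(\mathcal A)$, and $\langle \hat M,\hat N\rangle=\sum_{i\ge 0}(-1)^i\dim_k\operatorname{Ext}^i_{\mathcal A}(M,N)$ the Euler form. *Hall algebras.* For objects $L,M,N$ of an abelian category let $\operatorname{Ext}^1(M,N)_L$ be the set of equivalence classes of short exact sequences $0\to N\to L\to M\to 0$ with middle term $L$. The Ringel–Hall algebra $\mathcal H_{\rm tw}(\mathcal A)$ is the $\mathbb C$-vector space with basis the isomorphism classes $[M]\in\operatorname{Iso}(\mathcal A)$ and product $$[M]*[N]=v^{\langle\hat M,\hat N\rangle}\sum_{[L]}\frac{|\operatorname{Ext}^1_{\mathcal A}(M,N)_L|}{|\operatorname{Hom}_{\mathcal A}(M,N)|}[L].$$ Let $\mathcal C_2(\mathcal A)$ be the abelian category of 2-cyclic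 complexes $M_\bullet=(d_1\colon M_1\rightleftarrows M_0\colon d_0)$, $d_0d_1=0=d_1d_0$, and $\mathcal C_2(\mathcal P)$ its full subcategory of complexes of projectives. The algebra $\mathcal H_{\rm tw}(\mathcal C_2(\mathcal P))$ has as $\mathbb C$-basis the isomorphism classes $[M_\bullet]$ of objects of $\mathcal C_2(\mathcal P)$, and product $$[M_\bullet]*[N_\bullet]=v^{\langle\hat M_0,\hat N_0\rangle+\langle\hat M_1,\hat N_1\rangle}\sum_{[L_\bullet]}\frac{|\operatorname{Ext}^1_{\mathcal C_2(\mathcal A)}(M_\bullet,N_\bullet)_{L_\bullet}|}{|\operatorname{Hom}_{\mathcal C_2(\mathcal A)}(M_\bullet,N_\bullet)|}[L_\bullet].$$ Bridgeland's Hall algebra $\mathcal{DH}_2(\mathcal A)$ is the localization of $\mathcal H_{\rm tw}(\mathcal C_2(\mathcal P))$ at the classes $[M_\bullet]$ of acyclic complexes. For $P\in\mathcal P$ let $K_P$ (resp. $K_P^*$) be the acyclic complex with $P$ in both degrees and $d_1=1,\ d_0=0$ (resp. $d_1=0,\ d_0=1$). For $\alpha=\hat P-\hat Q\in K(\mathcal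 A)$ with $P,Q\in\mathcal P$ put $K_\alpha=[K_P]*[K_Q]^{-1}$ and $K^*_\alpha=[K^*_P]*[K^*_Q]^{-1}$ in $\mathcal{DH}_2(\mathcal A)$. *The elements $E_M$.* Every $M\in\mathcal A$ has a finite projective resolution $0\to P_n\xrightarrow{p_n}\cdots\xrightarrow{p_1}P_0\to M\to0$. Given one, put $M_i=\operatorname{Im}p_i$ for $1\le i\le n$, let $M_{\rm odd}$ and $M_{\rm even}$ be the direct sums of the $M_i$ with $1\le i\le n$ odd, respectively even, let $C_M=\big(\bigoplus_{i\text{ odd}}P_i\rightleftarrows\bigoplus_{i\text{ even}}P_i\big)$ be the 2-cyclic complex whose differentials are formed by the $p_i$, and put $$E_M=v^{\langle\hat M_{\rm odd}-\hat M_{\rm even},\hat M\rangle}\,K_{-\hat M_{\rm odd}}*K^*_{-\hat M_{\rm even}}*[C_M]\in\mathcal{DH}_2(\mathcal A).$$ *Claim.* For every choice of finite projective resolutions, one for each object of $\mathcal A$, the $\mathbb C$-linear map $$\varphi\colon\mathcal H_{\rm tw}(\mathcal A)\to\mathcal{DH}_2(\mathcal A),\qquad [M]\mapsto E_M,$$ is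 injective; that is, the elements $E_M$, with $M$ running over representatives of the isomorphism classes of objects of $\mathcal A$, are linearly independent in $\mathcal{DH}_2(\mathcal A)$. -/

import Mathlib

open CategoryTheory CategoryTheory.Limits

noncomputable section

namespace BridgelandHall

universe u v

attribute [local instance] Abelian.hasFiniteBiproducts

/-! ### Isomorphism classes, Hall numbers, Euler form -/

/-- The set `Iso(D)` of isomorphism classes of objects of a category `D`. -/
abbrev IsoClass (D : Type u) [Category.{v} D] : Type u := Quotient (isIsomorphicSetoid D)

/-- The isomorphism class `[X]`. -/
abbrev isoClass {D : Type u} [Category.{v} D] (X : D) : IsoClass D :=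
  Quotient.mk (isIsomorphicSetoid D) X

section Hall

variable {D : Type u} [Category.{v} D] [HasZeroMorphisms D]

/-- Short exact sequences `0 ⟶ N ⟶ L ⟶ M ⟶ 0` with given middle term `L`. -/
def Extension (M N L : D) : Type v :=
  {ip : (N ⟶ L) × (L ⟶ M) // ∃ w : ip.1 ≫ ip.2 = 0, (ShortComplex.mk ip.1 ip.2 w).ShortExact}

/-- Equivalence of extensions: an isomorphism of middle terms inducing the identity on `N`
and on `M`. -/
def extensionSetoid (M N L : D) : Setoid (Extension M N L) where
  r a b := ∃ g : L ≅ L, a.1.1 ≫ g.hom = b.1.1 ∧ g.hom ≫ b.1.2 = a.1.2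
  iseqv :=
    { refl := fun a => ⟨Iso.refl L, by simp, by simp⟩
      symm := by
        rintro a b ⟨g, h₁, h₂⟩
        exact ⟨g.symm, by simp [← h₁], by simp [← h₂]⟩
      trans := by
        rintro a b c ⟨g, h₁, h₂⟩ ⟨g', h₃, h₄⟩
        exact ⟨g.trans g', by simp [← h₃, ← h₁], by simp [h₄, h₂]⟩ }

/-- `Ext¹(M, N)_L`: the equivalence classes of short exact sequences
`0 ⟶ N ⟶ L ⟶ M ⟶ 0` with middle term `L`. -/
def ExtMiddle (M N L : D) : Type v := Quotient (extensionSetoid M N L)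

/-- The structure constant `|Ext¹(M, N)_L| / |Hom(M, N)|` of the Hall algebra. -/
def hallNumber (M N L : D) : ℂ := (Nat.card (ExtMiddle M N L) : ℂ) / (Nat.card (M ⟶ N) : ℂ)

/-- The product of basis vectors `[M] * [N] = t(M, N) ∑_{[L]} |Ext¹(M, N)_L| / |Hom(M, N)| [L]`
twisted by a scalar `t`, where the basis is indexed by `I` and `ob c` is an object representing
`c : I`. The sum is finite in the cases considered below. -/
def twistedHallProduct {I : Type*} (ob : I → D) (t : D → D → ℂ) (a b : I) : I →₀ ℂ :=
  ∑ᶠ c : I, Finsupp.single c (t (ob a) (ob b) * hallNumber (ob a) (ob b) (ob c))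

end Hall

/-- The number `v = √q`, where `q = |k|`. -/
def vParam (k : Type*) : ℂ := ((Real.sqrt (Nat.card k) : ℝ) : ℂ)

section Abelian

variable (k : Type*) [Field k] {𝒜 : Type u} [Category.{v} 𝒜] [Abelian 𝒜] [Linear k 𝒜]

/-- `dim_k Extⁱ(X, Y)`. -/
def extDim (X Y : 𝒜) (i : ℕ) : ℕ :=
  letI := HasExt.standard 𝒜
  Module.finrank k (Abelian.Ext.{max u v} X Y i)

/-- The Euler form `⟨X, Y⟩ = ∑ᵢ (-1)ⁱ dim_k Extⁱ(X, Y)`; the sum is finite when the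
global dimension is finite. -/
def eulerForm (X Y : 𝒜) : ℤ := ∑ᶠ i : ℕ, (-1 : ℤ) ^ i * (extDim k X Y i : ℤ)

variable (𝒜)

/-- `𝒜` is finitary over `k`: all Hom-spaces and all Ext-spaces are finite dimensional. -/
structure IsFinitary : Prop where
  finite_hom : ∀ X Y : 𝒜, Module.Finite k (X ⟶ Y)
  finite_ext : ∀ (X Y : 𝒜) (i : ℕ),
    letI := HasExt.standard 𝒜
    Module.Finite k (Abelian.Ext.{max u v} X Y i)

/-- `𝒜` has finite global dimension. -/
def HasFiniteGlobalDimension (𝒜 : Type u) [Category.{v} 𝒜] [Abelian 𝒜] : Prop :=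
  ∃ d : ℕ, ∀ X : 𝒜, HasProjectiveDimensionLE X d

/-- The (twisted) Ringel–Hall algebra `H_tw(𝒜)`, with `ℂ`-basis `Iso(𝒜)`. -/
@[nolint unusedArguments]
def RingelHall (k : Type*) [Field k] (𝒜 : Type u) [Category.{v} 𝒜] [Abelian 𝒜] [Linear k 𝒜] :
    Type u := IsoClass 𝒜 →₀ ℂ

instance : AddCommGroup (RingelHall k 𝒜) := inferInstanceAs (AddCommGroup (IsoClass 𝒜 →₀ ℂ))
instance : Module ℂ (RingelHall k 𝒜) := inferInstanceAs (Module ℂ (IsoClass 𝒜 →₀ ℂ))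

/-- The bilinear multiplication of `H_tw(𝒜)`, with
`[M] * [N] = v ^ ⟨M, N⟩ ∑_{[L]} |Ext¹(M, N)_L| / |Hom(M, N)| [L]`. -/
instance : Mul (RingelHall k 𝒜) where
  mul x y := Finsupp.sum x fun a r => Finsupp.sum y fun b s =>
    (r * s) • twistedHallProduct (Quotient.out : IsoClass 𝒜 → 𝒜)
      (fun M N => vParam k ^ eulerForm k M N) a b

/-- The basis of `H_tw(𝒜)` formed by the isomorphism classes. -/
def RingelHall.basis : Module.Basis (IsoClass 𝒜) ℂ (RingelHall k 𝒜) := Finsupp.basisSingleOne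

end Abelian

/-! ### The Grothendieck group -/

section Grothendieck

variable (𝒜 : Type u) [Category.{v} 𝒜] [Abelian 𝒜]

/-- The relations `[X₂] = [X₁] + [X₃]` for short exact sequences `0 ⟶ X₁ ⟶ X₂ ⟶ X₃ ⟶ 0`. -/
def grothendieckRelations : AddSubgroup (FreeAbelianGroup 𝒜) :=
  AddSubgroup.closure {z | ∃ S : ShortComplex 𝒜, S.ShortExact ∧
    z = FreeAbelianGroup.of S.X₂ - FreeAbelianGroup.of S.X₁ - FreeAbelianGroup.of S.X₃}

/-- The Grothendieck group `K(𝒜)`. -/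
abbrev GrothendieckK : Type u := FreeAbelianGroup 𝒜 ⧸ grothendieckRelations 𝒜

variable {𝒜}

/-- The class of an object in `K(𝒜)`. -/
def kClass (X : 𝒜) : GrothendieckK 𝒜 := QuotientAddGroup.mk (FreeAbelianGroup.of X)

end Grothendieck

/-! ### 2-cyclic complexes -/

section Complexes

/-- The category `C₂(𝒜)` of 2-cyclic complexes: objects `X 0`, `X 1` with
differentials `d 1 0 : X 1 ⟶ X 0` and `d 0 1 : X 0 ⟶ X 1` whose two composites vanish. -/
abbrev C₂ (𝒜 : Type u) [Category.{v} 𝒜] [Preadditive 𝒜] : Type (max u v) :=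
  HomologicalComplex 𝒜 (ComplexShape.up (ZMod 2))

/-- The 2-cyclic complexes of projective objects. -/
def isProjectiveComplex (𝒜 : Type u) [Category.{v} 𝒜] [Preadditive 𝒜] :
    ObjectProperty (C₂ 𝒜) := fun X => ∀ i, Projective (X.X i)

/-- The full subcategory `C₂(𝒫)` of `C₂(𝒜)`. -/
abbrev C₂P (𝒜 : Type u) [Category.{v} 𝒜] [Preadditive 𝒜] : Type (max u v) :=
  (isProjectiveComplex 𝒜).FullSubcategory

variable {𝒜 : Type u} [Category.{v} 𝒜] [Abelian 𝒜]

/-- The complex with `P` in both degrees whose differential is the identity from degree `a` to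
degree `a + 1` and zero in the other direction. -/
def diskComplex (a : ZMod 2) (P : 𝒜) : C₂ 𝒜 where
  X _ := P
  d i j := if i = a ∧ j = a + 1 then 𝟙 P else 0
  shape i j h := by
    rw [if_neg]
    rintro ⟨rfl, rfl⟩
    exact h rfl
  d_comp_d' i j l _ _ := by
    by_cases h : i = a ∧ j = a + 1
    · rw [if_neg (c := j = a ∧ l = a + 1), comp_zero]
      rintro ⟨h', -⟩
      rw [h.2] at h'
      simp at h'
    · rw [if_neg h, zero_comp]

/-- A disk complex is acyclic. -/
theorem diskComplex_acyclic (a : ZMod 2) (P : 𝒜) : (diskComplex a P).Acyclic := by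
  intro i
  have hp : (ComplexShape.up (ZMod 2)).prev i = i + 1 :=
    ComplexShape.prev_eq' _ (show i + 1 + 1 = i by rw [add_assoc]; exact add_zero i)
  have hn : (ComplexShape.up (ZMod 2)).next i = i + 1 := ComplexShape.next_eq' _ rfl
  rw [HomologicalComplex.exactAt_iff' _ _ _ _ hp hn]
  have key : ∀ i a : ZMod 2, i = a ∨ (i + 1 = a ∧ i = a + 1) := by decide
  rcases key i a with rfl | ⟨h₁, h₂⟩
  · have hg : ((diskComplex i P).sc' (i + 1) i (i + 1)).g = 𝟙 P := by
      simp [diskComplex]; rfl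
    have hf : ((diskComplex i P).sc' (i + 1) i (i + 1)).f = 0 := by
      simp [diskComplex]; rfl
    rw [ShortComplex.exact_iff_mono _ hf, hg]
    exact inferInstanceAs (Mono (𝟙 P))
  · have hf : ((diskComplex a P).sc' (i + 1) i (i + 1)).f = 𝟙 P := by
      simp only [HomologicalComplex.shortComplexFunctor'_obj_f, diskComplex]
      exact if_pos ⟨h₁, h₂⟩
    have hg : ((diskComplex a P).sc' (i + 1) i (i + 1)).g = 0 := by
      simp only [HomologicalComplex.shortComplexFunctor'_obj_g, diskComplex]
      exact if_neg (by rintro ⟨h, -⟩; rw [h₂] at h; simp at h)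
    rw [ShortComplex.exact_iff_epi _ hg, hf]
    exact inferInstanceAs (Epi (𝟙 P))

/-- `K_P`, that is `P ⟶ P` with `d₁ = 1` and `d₀ = 0`. -/
def complexK (P : 𝒜) [hP : Projective P] : C₂P 𝒜 := ⟨diskComplex 1 P, fun _ => hP⟩

/-- `K_P^*`, that is `P ⟶ P` with `d₁ = 0` and `d₀ = 1`. -/
def complexKStar (P : 𝒜) [hP : Projective P] : C₂P 𝒜 := ⟨diskComplex 0 P, fun _ => hP⟩

/-- A finite direct sum of projective objects is projective. -/
theorem projective_biproduct {ι : Type} [Finite ι] (g : ι → 𝒜) (hg : ∀ i, Projective (g i)) :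
    Projective (⨁ g) where
  factors f e _ := ⟨biproduct.desc fun b => Projective.factorThru (biproduct.ι g b ≫ f) e,
    biproduct.hom_ext' _ _ fun b => by simp⟩

/-- The 2-cyclic complex obtained by folding `P_n ⟶ ⋯ ⟶ P_1 ⟶ P_0`: in degree `j` it is the direct
sum of the `P_i` with `0 ≤ i ≤ n` and `i ≡ j` mod 2, and the differential is the matrix formed
by the differentials `P_{i+1} ⟶ P_i` (the other entries `d i i'` are zero). -/
def fold (P : ChainComplex 𝒜 ℕ) (n : ℕ) : C₂ 𝒜 where
  X j := ⨁ fun i : {i : Fin (n + 1) // ((i : ℕ) : ZMod 2) = j} => P.X (i.1 : ℕ)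
  d j j' := biproduct.matrix fun i i' => P.d (i.1 : ℕ) (i'.1 : ℕ)
  shape j j' h := by
    ext i' i
    simp only [biproduct.matrix_π, biproduct.ι_desc, zero_comp, comp_zero]
    refine P.shape _ _ fun hr => h ?_
    have hr' : (i'.1 : ℕ) + 1 = (i.1 : ℕ) := hr
    change j + 1 = j'
    rw [← i.2, ← i'.2, ← hr']
    push_cast
    rw [add_assoc]
    exact add_zero _
  d_comp_d' j j' j'' _ _ := by
    ext i'' i
    simp only [Category.assoc, biproduct.matrix_π, comp_zero, zero_comp]
    rw [biproduct.ι_matrix_assoc, biproduct.lift_desc]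
    simp

end Complexes

/-! ### Bridgeland's Hall algebra -/

section Bridgeland

variable (k : Type*) [Field k] (𝒜 : Type u) [Category.{v} 𝒜] [Abelian 𝒜] [Linear k 𝒜]

/-- The twisted Hall algebra `H_tw(C₂(𝒫))`, with `ℂ`-basis `Iso(C₂(𝒫))`. -/
@[nolint unusedArguments]
def HallC₂P (k : Type*) [Field k] (𝒜 : Type u) [Category.{v} 𝒜] [Abelian 𝒜] [Linear k 𝒜] :
    Type (max u v) := IsoClass (C₂P 𝒜) →₀ ℂ

instance : AddCommGroup (HallC₂P k 𝒜) := inferInstanceAs (AddCommGroup (IsoClass (C₂P 𝒜) →₀ ℂ))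
instance : Module ℂ (HallC₂P k 𝒜) := inferInstanceAs (Module ℂ (IsoClass (C₂P 𝒜) →₀ ℂ))

/-- The bilinear multiplication of `H_tw(C₂(𝒫))`, with
`[M] * [N] = v ^ (⟨M₀, N₀⟩ + ⟨M₁, N₁⟩) ∑_{[L]} |Ext¹(M, N)_L| / |Hom(M, N)| [L]`,
where `Ext¹` and `Hom` are taken in `C₂(𝒜)`. -/
instance : Mul (HallC₂P k 𝒜) where
  mul x y := Finsupp.sum x fun a r => Finsupp.sum y fun b s =>
    (r * s) • twistedHallProduct (fun c : IsoClass (C₂P 𝒜) => c.out.obj)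
      (fun M N => vParam k ^ (eulerForm k (M.X 0) (N.X 0) + eulerForm k (M.X 1) (N.X 1))) a b

/-- The basis of `H_tw(C₂(𝒫))` formed by the isomorphism classes. -/
def HallC₂P.basis : Module.Basis (IsoClass (C₂P 𝒜)) ℂ (HallC₂P k 𝒜) := Finsupp.basisSingleOne

/-- Generators of the localization: the basis elements `[M]` of `H_tw(C₂(𝒫))` and a formal inverse
of `[M]` for each acyclic `M`. -/
inductive LocGen : Type (max u v)
  | cls (c : IsoClass (C₂P 𝒜))
  | inv (M : C₂P 𝒜) (hM : M.obj.Acyclic)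

/-- The linear map from `H_tw(C₂(𝒫))` to the free algebra on the generators. -/
def toFree : HallC₂P k 𝒜 →ₗ[ℂ] FreeAlgebra ℂ (LocGen 𝒜) :=
  (HallC₂P.basis k 𝒜).constr ℂ fun c => FreeAlgebra.ι ℂ (LocGen.cls c)

/-- The relations of the localization: the map from `H_tw(C₂(𝒫))` is a homomorphism of unital
algebras (the unit of `H_tw(C₂(𝒫))` is `[0]`), and the formal inverse of `[M]` for `M` acyclic
is a two-sided inverse of `[M]`. -/
inductive LocRel : FreeAlgebra ℂ (LocGen 𝒜) → FreeAlgebra ℂ (LocGen 𝒜) → Prop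
  | mul (x y : HallC₂P k 𝒜) : LocRel (toFree k 𝒜 x * toFree k 𝒜 y) (toFree k 𝒜 (x * y))
  | one (Z : C₂P 𝒜) (hZ : IsZero Z.obj) :
      LocRel (toFree k 𝒜 (HallC₂P.basis k 𝒜 (isoClass Z))) 1
  | mul_inv (M : C₂P 𝒜) (hM : M.obj.Acyclic) :
      LocRel (toFree k 𝒜 (HallC₂P.basis k 𝒜 (isoClass M)) * FreeAlgebra.ι ℂ (LocGen.inv M hM)) 1
  | inv_mul (M : C₂P 𝒜) (hM : M.obj.Acyclic) :
      LocRel (FreeAlgebra.ι ℂ (LocGen.inv M hM) * toFree k 𝒜 (HallC₂P.basis k 𝒜 (isoClass M))) 1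

/-- Bridgeland's Hall algebra `DH₂(𝒜)`: the localization of `H_tw(C₂(𝒫))` at the classes of
acyclic complexes, that is the `ℂ`-algebra which is universal among those with a homomorphism from
`H_tw(C₂(𝒫))` that sends these classes to invertible elements. -/
def DH₂ : Type (max u v) := RingQuot (LocRel k 𝒜)

instance : Ring (DH₂ k 𝒜) := inferInstanceAs (Ring (RingQuot (LocRel k 𝒜)))
instance : Algebra ℂ (DH₂ k 𝒜) := inferInstanceAs (Algebra ℂ (RingQuot (LocRel k 𝒜)))

/-- The canonical map from the free algebra. -/
def DH₂.mk : FreeAlgebra ℂ (LocGen 𝒜) →ₐ[ℂ] DH₂ k 𝒜 := RingQuot.mkAlgHom ℂ (LocRel k 𝒜)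

/-- The canonical map `H_tw(C₂(𝒫)) ⟶ DH₂(𝒜)`. -/
def DH₂.ofHall : HallC₂P k 𝒜 →ₗ[ℂ] DH₂ k 𝒜 := (DH₂.mk k 𝒜).toLinearMap ∘ₗ toFree k 𝒜

variable {𝒜}

/-- The element `[M]` of `DH₂(𝒜)` for `M` in `C₂(𝒫)`. -/
def DH₂.cls (M : C₂P 𝒜) : DH₂ k 𝒜 := DH₂.ofHall k 𝒜 (HallC₂P.basis k 𝒜 (isoClass M))

/-- The invertible element `[M]` of `DH₂(𝒜)` for `M` acyclic. -/
def DH₂.unit (M : C₂P 𝒜) (hM : M.obj.Acyclic) : (DH₂ k 𝒜)ˣ where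
  val := DH₂.cls k M
  inv := DH₂.mk k 𝒜 (FreeAlgebra.ι ℂ (LocGen.inv M hM))
  val_inv := by
    have h := RingQuot.mkAlgHom_rel ℂ (LocRel.mul_inv (k := k) M hM)
    rw [map_mul, map_one] at h
    exact h
  inv_val := by
    have h := RingQuot.mkAlgHom_rel ℂ (LocRel.inv_mul (k := k) M hM)
    rw [map_mul, map_one] at h
    exact h

/-- `[K_P]` as an invertible element of `DH₂(𝒜)`. -/
def unitK (P : 𝒜) [Projective P] : (DH₂ k 𝒜)ˣ :=
  DH₂.unit k (complexK P) (diskComplex_acyclic 1 P)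

/-- `[K_P^*]` as an invertible element of `DH₂(𝒜)`. -/
def unitKStar (P : 𝒜) [Projective P] : (DH₂ k 𝒜)ˣ :=
  DH₂.unit k (complexKStar P) (diskComplex_acyclic 0 P)

/-- `α ∈ K(𝒜)` is the difference of the classes of the projective objects `P` and `Q`. -/
def IsProjDiff (α : GrothendieckK 𝒜) (PQ : 𝒜 × 𝒜) : Prop :=
  Projective PQ.1 ∧ Projective PQ.2 ∧ α = kClass PQ.1 - kClass PQ.2

open Classical in
/-- `K_α = [K_P] * [K_Q]⁻¹`, where `α = P̂ - Q̂` with `P`, `Q` projective. -/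
def elemK (α : GrothendieckK 𝒜) : (DH₂ k 𝒜)ˣ :=
  if h : ∃ PQ : 𝒜 × 𝒜, IsProjDiff α PQ then
    haveI := h.choose_spec.1
    haveI := h.choose_spec.2.1
    unitK k h.choose.1 * (unitK k h.choose.2)⁻¹
  else 1

open Classical in
/-- `K_α^* = [K_P^*] * [K_Q^*]⁻¹`, where `α = P̂ - Q̂` with `P`, `Q` projective. -/
def elemKStar (α : GrothendieckK 𝒜) : (DH₂ k 𝒜)ˣ :=
  if h : ∃ PQ : 𝒜 × 𝒜, IsProjDiff α PQ then
    haveI := h.choose_spec.1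
    haveI := h.choose_spec.2.1
    unitKStar k h.choose.1 * (unitKStar k h.choose.2)⁻¹
  else 1

end Bridgeland

/-! ### The elements `E_M` -/

section Elements

variable {𝒜 : Type u} [Category.{v} 𝒜] [Abelian 𝒜]

/-- A finite projective resolution `0 ⟶ P_n ⟶ ⋯ ⟶ P_1 ⟶ P_0 ⟶ M ⟶ 0`. -/
structure FiniteResolution (M : 𝒜) extends ProjectiveResolution M where
  /-- the number `n` -/
  length : ℕ
  /-- the resolution vanishes beyond degree `n` -/
  isZero_of_gt : ∀ i, length < i → IsZero (complex.X i)

namespace FiniteResolution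

variable {M : 𝒜} (P : FiniteResolution M)

/-- `M_{j+1}`, the image of `p_{j+1} : P_{j+1} ⟶ P_j`. -/
def syzygy (j : ℕ) : 𝒜 := image (P.complex.d (j + 1) j)

/-- `M_odd`, the direct sum of the `M_i` with `1 ≤ i ≤ n` odd (here `i = j + 1`). -/
def oddPart : 𝒜 := ⨁ fun j : {j : Fin P.length // Odd ((j : ℕ) + 1)} => P.syzygy j.1

/-- `M_even`, the direct sum of the `M_i` with `1 ≤ i ≤ n` even (here `i = j + 1`). -/
def evenPart : 𝒜 := ⨁ fun j : {j : Fin P.length // Even ((j : ℕ) + 1)} => P.syzygy j.1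

/-- `C_M`, the 2-cyclic complex `⨁_{i odd} P_i ⇄ ⨁_{i even} P_i`. -/
def foldedComplex : C₂P 𝒜 :=
  ⟨fold P.complex P.length, fun _ => projective_biproduct _ fun i => P.projective i.1⟩

variable (k : Type*) [Field k] [Linear k 𝒜]

/-- `E_M = v ^ ⟨M_odd - M_even, M⟩ K_{-M_odd} * K^*_{-M_even} * [C_M]`, computed from the
given resolution of `M`. -/
def elemE : DH₂ k 𝒜 :=
  vParam k ^ (eulerForm k P.oddPart M - eulerForm k P.evenPart M) •
    ((elemK k (-kClass P.oddPart) : DH₂ k 𝒜) * (elemKStar k (-kClass P.evenPart) : DH₂ k 𝒜) *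
      DH₂.cls k P.foldedComplex)

end FiniteResolution

/-- The linear map `φ : H_tw(𝒜) ⟶ DH₂(𝒜)`, `[M] ↦ E_M`, where `E_M` is computed from the
resolution `R M`. -/
def phi (k : Type*) [Field k] [Linear k 𝒜] (R : ∀ M : 𝒜, FiniteResolution M) :
    RingelHall k 𝒜 →ₗ[ℂ] DH₂ k 𝒜 :=
  (RingelHall.basis k 𝒜).constr ℂ fun c => (R c.out).elemE k

end Elements

end BridgelandHall

end

open CategoryTheory CategoryTheory.Limits

noncomputable section

namespace BridgelandHall

universe u v

attribute [local instance] Abelian.hasFiniteBiproducts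

/-! The elements E_M are separated by explicit linear functionals, so nothing about the size of the
localization `DH₂` has to be known beforehand: one sufficiently rich representation of it is enough.

Extensions of complexes of projectives split degreewise, and v^⟨P, Y⟩ is the square root of |Hom(P,
Y)| for P projective. Hence the twisted product is [M] * [N] = |Hom⁰(M, N)|^(-1/2) ∑_z [twist z],
where z runs over the degree-one cocycles and Hom⁰ denotes families of morphisms of the components
(`Cocycle.card_extMiddle_mul`, `twistedHallProduct_eq`). Associativity becomes the remark that a
filtration with three subquotients can be built from either end (`act_mul_act`).

The Hall algebra acts on functionals by (N · f)(X) = f([X] * [N]). The functionals with f([K] * [X])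
= f([X]) for all disk complexes K form a submodule `invariants`. Extensions by a disk split, so [X]
* [K] and [K] * [X] are both nonzero multiples of [K ⊕ X]; on `invariants` the class [K] therefore
multiplies values pointwise by nonzero scalars (`actInv_disk_apply`) and is invertible. Finite
global dimension makes every acyclic complex of projectives a sum of two disks
(`exists_iso_sum_disk`), so all acyclic classes act invertibly, and the universal property of the
localization gives the representation `rep`.

After evaluation at the zero complex, E_M sends f to a nonzero multiple of f([C_M])
(`exists_rep_elemE_apply`). Each C has an invariant functional `testFun C` that is nonzero at C and
vanishes at X unless H₀(X) ≅ H₀(C) (`testFun_mem_invariants`). Since H₀(C_M) ≅ M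
(`nonempty_homology_fold_iso`), the functional of C_M kills every term of a linear relation except
that of M. -/

/-! ### Twisted direct sums of complexes -/

section Cocycles

variable {ι : Type*} {c : ComplexShape ι} {𝒜 : Type u} [Category.{v} 𝒜] [Preadditive 𝒜]

/-- The cocycles of degree one in the Hom-complex from `M` to `N`. -/
@[ext]
structure Cocycle (M N : HomologicalComplex 𝒜 c) where
  /-- the components of the cocycle -/
  h : ∀ i j, M.X i ⟶ N.X j
  shape : ∀ i j, ¬ c.Rel i j → h i j = 0
  comm : ∀ i j l, M.d i j ≫ h j l + h i j ≫ N.d j l = 0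

namespace Cocycle

variable {M N : HomologicalComplex 𝒜 c}

instance [Finite ι] [∀ X Y : 𝒜, Finite (X ⟶ Y)] : Finite (Cocycle M N) :=
  Finite.of_injective (fun z : Cocycle M N => z.h) fun _ _ h => Cocycle.ext h

/-- The zero cocycle. -/
def zero (M N : HomologicalComplex 𝒜 c) : Cocycle M N where
  h _ _ := 0
  shape _ _ _ := rfl
  comm _ _ _ := by simp

@[simp]
lemma zero_h (i j : ι) : (zero M N).h i j = 0 := rfl

/-- The coboundary map. -/
def δ (M N : HomologicalComplex 𝒜 c) : (∀ i, M.X i ⟶ N.X i) →+ (∀ i j, M.X i ⟶ N.X j) where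
  toFun s i j := s i ≫ N.d i j - M.d i j ≫ s j
  map_zero' := by ext; simp
  map_add' s t := by ext; simp; abel

lemma δ_apply (s : ∀ i, M.X i ⟶ N.X i) (i j : ι) :
    δ M N s i j = s i ≫ N.d i j - M.d i j ≫ s j := rfl

/-- Adding a coboundary to a cocycle. -/
@[simps]
def addδ (z : Cocycle M N) (s : ∀ i, M.X i ⟶ N.X i) : Cocycle M N where
  h := z.h + δ M N s
  shape i j hij := by
    simp [δ_apply, z.shape _ _ hij, N.shape _ _ hij, M.shape _ _ hij]
  comm i j l := by
    have := z.comm i j l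
    simp only [Pi.add_apply, δ_apply, Preadditive.comp_add, Preadditive.add_comp,
      Preadditive.comp_sub, Preadditive.sub_comp, Category.assoc, HomologicalComplex.d_comp_d,
      HomologicalComplex.d_comp_d_assoc, zero_comp, comp_zero]
    rw [← this]; abel

/-- The transport of a cocycle along isomorphisms. -/
@[simps]
def congr {M' N' : HomologicalComplex 𝒜 c} (e : M ≅ M') (e' : N ≅ N') (z : Cocycle M N) :
    Cocycle M' N' where
  h i j := e.inv.f i ≫ z.h i j ≫ e'.hom.f j
  shape i j hij := by simp [z.shape _ _ hij]
  comm i j l := by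
    have := congrArg (fun t => e.inv.f i ≫ t ≫ e'.hom.f l) (z.comm i j l)
    simpa using this

/-- Isomorphic pairs of complexes have the same cocycles. -/
def congrEquiv {M' N' : HomologicalComplex 𝒜 c} (e : M ≅ M') (e' : N ≅ N') :
    Cocycle M N ≃ Cocycle M' N' where
  toFun := congr e e'
  invFun := congr e.symm e'.symm
  left_inv z := by ext; simp [congr, ← HomologicalComplex.comp_f, ← HomologicalComplex.comp_f_assoc]
  right_inv z := by ext; simp [congr, ← HomologicalComplex.comp_f, ← HomologicalComplex.comp_f_assoc]

variable [HasBinaryBiproducts 𝒜]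

/-- The extension of `M` by `N` given by a cocycle: degreewise the direct sum. -/
def twist (z : Cocycle M N) : HomologicalComplex 𝒜 c where
  X i := N.X i ⊞ M.X i
  d i j := biprod.map (N.d i j) (M.d i j) + biprod.snd ≫ z.h i j ≫ biprod.inl
  shape i j hij := by
    ext <;> simp [N.shape _ _ hij, M.shape _ _ hij, z.shape _ _ hij]
  d_comp_d' i j l _ _ := by
    have := z.comm i j l
    ext <;> simp
    rw [add_comm]; exact this

/-- The components of the inclusion of `N`. -/
def inl (z : Cocycle M N) (i : ι) : N.X i ⟶ z.twist.X i :=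
  (biprod.inl : N.X i ⟶ N.X i ⊞ M.X i)

/-- The components of the degreewise section of the projection to `M`. -/
def inr (z : Cocycle M N) (i : ι) : M.X i ⟶ z.twist.X i :=
  (biprod.inr : M.X i ⟶ N.X i ⊞ M.X i)

/-- The components of the degreewise retraction of the inclusion of `N`. -/
def fst (z : Cocycle M N) (i : ι) : z.twist.X i ⟶ N.X i :=
  (biprod.fst : N.X i ⊞ M.X i ⟶ N.X i)

/-- The components of the projection to `M`. -/
def snd (z : Cocycle M N) (i : ι) : z.twist.X i ⟶ M.X i :=
  (biprod.snd : N.X i ⊞ M.X i ⟶ M.X i)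

@[simp]
lemma inl_fst (z : Cocycle M N) (i : ι) : z.inl i ≫ z.fst i = 𝟙 _ := biprod.inl_fst

@[simp]
lemma inl_snd (z : Cocycle M N) (i : ι) : z.inl i ≫ z.snd i = 0 := biprod.inl_snd

@[simp]
lemma inr_fst (z : Cocycle M N) (i : ι) : z.inr i ≫ z.fst i = 0 := biprod.inr_fst

@[simp]
lemma inr_snd (z : Cocycle M N) (i : ι) : z.inr i ≫ z.snd i = 𝟙 _ := biprod.inr_snd

@[simp]
lemma inl_fst_assoc (z : Cocycle M N) (i : ι) {T : 𝒜} (f : N.X i ⟶ T) :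
    z.inl i ≫ z.fst i ≫ f = f := by
  rw [← Category.assoc, inl_fst, Category.id_comp]

@[simp]
lemma inl_snd_assoc (z : Cocycle M N) (i : ι) {T : 𝒜} (f : M.X i ⟶ T) :
    z.inl i ≫ z.snd i ≫ f = 0 := by
  rw [← Category.assoc, inl_snd, zero_comp]

@[simp]
lemma inr_fst_assoc (z : Cocycle M N) (i : ι) {T : 𝒜} (f : N.X i ⟶ T) :
    z.inr i ≫ z.fst i ≫ f = 0 := by
  rw [← Category.assoc, inr_fst, zero_comp]

@[simp]
lemma inr_snd_assoc (z : Cocycle M N) (i : ι) {T : 𝒜} (f : M.X i ⟶ T) :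
    z.inr i ≫ z.snd i ≫ f = f := by
  rw [← Category.assoc, inr_snd, Category.id_comp]

lemma hom_ext (z : Cocycle M N) {i : ι} {T : 𝒜} {f g : T ⟶ z.twist.X i}
    (h₁ : f ≫ z.fst i = g ≫ z.fst i) (h₂ : f ≫ z.snd i = g ≫ z.snd i) : f = g :=
  biprod.hom_ext (X := N.X i) (Y := M.X i) f g h₁ h₂

lemma hom_ext' (z : Cocycle M N) {i : ι} {T : 𝒜} {f g : z.twist.X i ⟶ T}
    (h₁ : z.inl i ≫ f = z.inl i ≫ g) (h₂ : z.inr i ≫ f = z.inr i ≫ g) : f = g :=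
  biprod.hom_ext' (X := N.X i) (Y := M.X i) f g h₁ h₂

lemma total (z : Cocycle M N) (i : ι) :
    z.fst i ≫ z.inl i + z.snd i ≫ z.inr i = 𝟙 (z.twist.X i) :=
  z.hom_ext (by simp) (by simp)

@[simp]
lemma inl_twist_d (z : Cocycle M N) (i j : ι) :
    z.inl i ≫ z.twist.d i j = N.d i j ≫ z.inl j := by
  have : (biprod.inl : N.X i ⟶ N.X i ⊞ M.X i) ≫
      (biprod.map (N.d i j) (M.d i j) + biprod.snd ≫ z.h i j ≫ biprod.inl) =
        N.d i j ≫ biprod.inl := by simp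
  exact this

@[simp]
lemma inr_twist_d (z : Cocycle M N) (i j : ι) :
    z.inr i ≫ z.twist.d i j = M.d i j ≫ z.inr j + z.h i j ≫ z.inl j := by
  have : (biprod.inr : M.X i ⟶ N.X i ⊞ M.X i) ≫
      (biprod.map (N.d i j) (M.d i j) + biprod.snd ≫ z.h i j ≫ biprod.inl) =
        M.d i j ≫ biprod.inr + z.h i j ≫ biprod.inl := by simp
  exact this

@[simp]
lemma inl_twist_d_assoc (z : Cocycle M N) (i j : ι) {T : 𝒜} (f : z.twist.X j ⟶ T) :
    z.inl i ≫ z.twist.d i j ≫ f = N.d i j ≫ z.inl j ≫ f := by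
  rw [← Category.assoc, inl_twist_d, Category.assoc]

@[simp]
lemma inr_twist_d_assoc (z : Cocycle M N) (i j : ι) {T : 𝒜} (f : z.twist.X j ⟶ T) :
    z.inr i ≫ z.twist.d i j ≫ f = M.d i j ≫ z.inr j ≫ f + z.h i j ≫ z.inl j ≫ f := by
  rw [← Category.assoc, inr_twist_d, Preadditive.add_comp, Category.assoc, Category.assoc]

@[simp]
lemma twist_d_fst (z : Cocycle M N) (i j : ι) :
    z.twist.d i j ≫ z.fst j = z.fst i ≫ N.d i j + z.snd i ≫ z.h i j :=
  z.hom_ext' (by simp) (by simp)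

@[simp]
lemma twist_d_snd (z : Cocycle M N) (i j : ι) :
    z.twist.d i j ≫ z.snd j = z.snd i ≫ M.d i j :=
  z.hom_ext' (by simp) (by simp)

@[simp]
lemma twist_d_fst_assoc (z : Cocycle M N) (i j : ι) {T : 𝒜} (f : N.X j ⟶ T) :
    z.twist.d i j ≫ z.fst j ≫ f = z.fst i ≫ N.d i j ≫ f + z.snd i ≫ z.h i j ≫ f := by
  rw [← Category.assoc, twist_d_fst, Preadditive.add_comp, Category.assoc, Category.assoc]

@[simp]
lemma twist_d_snd_assoc (z : Cocycle M N) (i j : ι) {T : 𝒜} (f : M.X j ⟶ T) :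
    z.twist.d i j ≫ z.snd j ≫ f = z.snd i ≫ M.d i j ≫ f := by
  rw [← Category.assoc, twist_d_snd, Category.assoc]

lemma twist_projective (z : Cocycle M N) (i : ι) [Projective (M.X i)]
    [Projective (N.X i)] : Projective (z.twist.X i) :=
  inferInstanceAs (Projective (N.X i ⊞ M.X i))

/-- The transport of a cocycle does not change the extension. -/
def twistCongr {M' N' : HomologicalComplex 𝒜 c} (e : M ≅ M') (e' : N ≅ N') (z : Cocycle M N) :
    z.twist ≅ (congr e e' z).twist :=
  HomologicalComplex.Hom.isoOfComponents
    (fun i =>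
      { hom := z.fst i ≫ e'.hom.f i ≫ (congr e e' z).inl i +
          z.snd i ≫ e.hom.f i ≫ (congr e e' z).inr i
        inv := (congr e e' z).fst i ≫ e'.inv.f i ≫ z.inl i +
          (congr e e' z).snd i ≫ e.inv.f i ≫ z.inr i
        hom_inv_id := by
          simp [← HomologicalComplex.comp_f_assoc, total]
        inv_hom_id := by
          simp [← HomologicalComplex.comp_f_assoc, total] })
    (fun i j _ => by
      apply hom_ext <;> apply hom_ext' <;> simp [← HomologicalComplex.comp_f_assoc])

/-- Cohomologous cocycles give isomorphic extensions. -/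
def twistAddδ (z : Cocycle M N) (s : ∀ i, M.X i ⟶ N.X i) : (z.addδ s).twist ≅ z.twist :=
  HomologicalComplex.Hom.isoOfComponents
    (fun i =>
      { hom := (z.addδ s).fst i ≫ z.inl i + (z.addδ s).snd i ≫ (z.inr i + s i ≫ z.inl i)
        inv := z.fst i ≫ (z.addδ s).inl i +
          z.snd i ≫ ((z.addδ s).inr i - s i ≫ (z.addδ s).inl i)
        hom_inv_id := by apply hom_ext <;> apply hom_ext' <;> simp
        inv_hom_id := by apply hom_ext <;> apply hom_ext' <;> simp })
    (fun i j _ => by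
      apply hom_ext <;> apply hom_ext' <;> simp [δ_apply]
      abel)

/-- The inclusion of the subcomplex. -/
@[simps]
def inclusion (z : Cocycle M N) : N ⟶ z.twist where
  f := z.inl
  comm' _ _ _ := by simp

/-- The projection to the quotient complex. -/
@[simps]
def projection (z : Cocycle M N) : z.twist ⟶ M where
  f := z.snd
  comm' _ _ _ := by simp

lemma inclusion_twistAddδ (z : Cocycle M N) (s : ∀ i, M.X i ⟶ N.X i) :
    (z.addδ s).inclusion ≫ (z.twistAddδ s).hom = z.inclusion := by
  ext i; apply hom_ext <;> simp [twistAddδ]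

lemma twistAddδ_projection (z : Cocycle M N) (s : ∀ i, M.X i ⟶ N.X i) :
    (z.twistAddδ s).hom ≫ z.projection = (z.addδ s).projection := by
  ext i; apply hom_ext' <;> simp [twistAddδ]

/-- Restriction of a cocycle on an extension to the subcomplex. -/
@[simps]
def restrict {A B C : HomologicalComplex 𝒜 c} {z : Cocycle A B} (w : Cocycle z.twist C) :
    Cocycle B C where
  h i j := z.inl i ≫ w.h i j
  shape i j hij := by simp [w.shape _ _ hij]
  comm i j l := by
    have := congrArg (fun t => z.inl i ≫ t) (w.comm i j l)
    simpa using this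

/-- The cocycle on the quotient complex with values in the extension defined by `restrict`. -/
@[simps]
def assocFwd {A B C : HomologicalComplex 𝒜 c} {z : Cocycle A B} (w : Cocycle z.twist C) :
    Cocycle A (restrict w).twist where
  h i j := z.inr i ≫ w.h i j ≫ (restrict w).inl j + z.h i j ≫ (restrict w).inr j
  shape i j hij := by simp [z.shape _ _ hij, w.shape _ _ hij]
  comm i j l := by
    have h₁ := z.comm i j l
    have h₂ := congrArg (fun t => z.inr i ≫ t) (w.comm i j l)
    simp only [Preadditive.comp_add, inr_twist_d_assoc, comp_zero] at h₂
    apply hom_ext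
    · simp
      rw [← h₂]; abel
    · simpa using h₁

/-- Projection of a cocycle with values in an extension to the quotient complex. -/
@[simps]
def project {A B C : HomologicalComplex 𝒜 c} {z : Cocycle B C} (w : Cocycle A z.twist) :
    Cocycle A B where
  h i j := w.h i j ≫ z.snd j
  shape i j hij := by simp [w.shape _ _ hij]
  comm i j l := by
    have := congrArg (fun t => t ≫ z.snd l) (w.comm i j l)
    simpa using this

/-- The cocycle with values in the subcomplex on the extension defined by `project`. -/
@[simps]
def assocBwd {A B C : HomologicalComplex 𝒜 c} {z : Cocycle B C} (w : Cocycle A z.twist) :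
    Cocycle (project w).twist C where
  h i j := (project w).fst i ≫ z.h i j + (project w).snd i ≫ w.h i j ≫ z.fst j
  shape i j hij := by simp [z.shape _ _ hij, w.shape _ _ hij]
  comm i j l := by
    have h₁ := z.comm i j l
    have h₂ := congrArg (fun t => t ≫ z.fst l) (w.comm i j l)
    simp only [Preadditive.comp_add, twist_d_fst, Preadditive.add_comp,
      Category.assoc, zero_comp] at h₂
    apply hom_ext'
    · simpa using h₁
    · simp
      rw [← h₂]; abel

/-- Comparing `w` and `w'` on the two summands avoids a heterogeneous equality between cocycles on
different twists. -/
lemma sigma_ext {A B C : HomologicalComplex 𝒜 c} {z z' : Cocycle A B} (w : Cocycle z.twist C)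
    (w' : Cocycle z'.twist C) (h : ∀ i j, z.h i j = z'.h i j)
    (h₁ : ∀ i j, z.inl i ≫ w.h i j = z'.inl i ≫ w'.h i j)
    (h₂ : ∀ i j, z.inr i ≫ w.h i j = z'.inr i ≫ w'.h i j) :
    (⟨z, w⟩ : Σ z : Cocycle A B, Cocycle z.twist C) = ⟨z', w'⟩ := by
  obtain rfl : z = z' := by ext; apply h
  congr
  ext i j
  exact hom_ext' _ (h₁ i j) (h₂ i j)

lemma sigma_ext' {A B C : HomologicalComplex 𝒜 c} {z z' : Cocycle B C} (w : Cocycle A z.twist)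
    (w' : Cocycle A z'.twist) (h : ∀ i j, z.h i j = z'.h i j)
    (h₁ : ∀ i j, w.h i j ≫ z.fst j = w'.h i j ≫ z'.fst j)
    (h₂ : ∀ i j, w.h i j ≫ z.snd j = w'.h i j ≫ z'.snd j) :
    (⟨z, w⟩ : Σ z : Cocycle B C, Cocycle A z.twist) = ⟨z', w'⟩ := by
  obtain rfl : z = z' := by ext; apply h
  congr
  ext i j
  exact hom_ext _ (h₁ i j) (h₂ i j)

/-- Two-step filtrations with subquotients `C`, `B`, `A` can be built from either end. -/
def assocEquiv (A B C : HomologicalComplex 𝒜 c) :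
    (Σ z : Cocycle A B, Cocycle z.twist C) ≃ Σ z : Cocycle B C, Cocycle A z.twist where
  toFun z := ⟨restrict z.2, assocFwd z.2⟩
  invFun z := ⟨project z.2, assocBwd z.2⟩
  left_inv := by
    rintro ⟨z, w⟩
    apply sigma_ext <;> simp
  right_inv := by
    rintro ⟨z, w⟩
    apply sigma_ext' <;> simp

/-- The two ways of building a two-step filtration give isomorphic complexes. -/
def twistAssoc {A B C : HomologicalComplex 𝒜 c} {z : Cocycle A B} (w : Cocycle z.twist C) :
    w.twist ≅ (assocFwd w).twist :=
  HomologicalComplex.Hom.isoOfComponents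
    (fun i =>
      { hom := w.fst i ≫ (restrict w).inl i ≫ (assocFwd w).inl i +
          w.snd i ≫ (z.fst i ≫ (restrict w).inr i ≫ (assocFwd w).inl i + z.snd i ≫ (assocFwd w).inr i)
        inv := (assocFwd w).fst i ≫ ((restrict w).fst i ≫ w.inl i +
            (restrict w).snd i ≫ z.inl i ≫ w.inr i) +
          (assocFwd w).snd i ≫ z.inr i ≫ w.inr i
        hom_inv_id := by
          refine hom_ext' _ ?_ (hom_ext' _ ?_ ?_) <;> simp
        inv_hom_id := by
          refine hom_ext' _ (hom_ext' _ ?_ ?_) ?_ <;> simp })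
    (fun i j _ => by
      refine hom_ext _ (hom_ext _ ?_ ?_) ?_ <;> refine hom_ext' _ ?_ (hom_ext' _ ?_ ?_) <;> simp)

end Cocycle

end Cocycles

/-! ### Extensions of complexes with projective components -/

section Extensions

variable {ι : Type*} {c : ComplexShape ι} {𝒜 : Type u} [Category.{v} 𝒜] [Abelian 𝒜]

namespace Cocycle

variable {M N : HomologicalComplex 𝒜 c}

lemma twist_shortExact (z : Cocycle M N) (w : z.inclusion ≫ z.projection = 0) :
    (ShortComplex.mk z.inclusion z.projection w).ShortExact := by
  refine HomologicalComplex.shortExact_of_degreewise_shortExact _ fun i => ?_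
  exact (ShortComplex.Splitting.mk (z.fst i) (z.inr i) (z.inl_fst i) (z.inr_snd i)
    (z.total i)).shortExact

/-- The extension defined by a cocycle and an isomorphism to its middle term. -/
def extension {L : HomologicalComplex 𝒜 c} (z : Cocycle M N) (e : z.twist ≅ L) :
    Extension M N L :=
  have w : z.inclusion ≫ z.projection = 0 := by ext; simp
  ⟨(z.inclusion ≫ e.hom, e.inv ≫ z.projection), by simp [w],
    ShortComplex.shortExact_of_iso
      (ShortComplex.isoMk (Iso.refl N) e (Iso.refl M) (by simp) (by simp)) (z.twist_shortExact w)⟩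

/-- Projectivity of the components of `M` provides degreewise splittings `s`, `r`. With respect to
them the differential of `L` is triangular, and the cocycle is its off-diagonal entry. -/
lemma exists_extension_eq [∀ i, Projective (M.X i)] {L : HomologicalComplex 𝒜 c}
    (x : Extension M N L) : ∃ (z : Cocycle M N) (e : z.twist ≅ L), z.extension e = x := by
  obtain ⟨⟨a, p⟩, w, hx⟩ := x
  dsimp at w hx
  have hx' := fun i => hx.map_of_exact (HomologicalComplex.eval 𝒜 c i)
  have (i : ι) : Projective ((ShortComplex.mk a p w).map
    (HomologicalComplex.eval 𝒜 c i)).X₃ := inferInstanceAs (Projective (M.X i))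
  let σ := fun i => (hx' i).splittingOfProjective
  let s : ∀ i, M.X i ⟶ L.X i := fun i => (σ i).s
  let r : ∀ i, L.X i ⟶ N.X i := fun i => (σ i).r
  have sp : ∀ i, s i ≫ p.f i = 𝟙 _ := fun i => (σ i).s_g
  have ar : ∀ i, a.f i ≫ r i = 𝟙 _ := fun i => (σ i).f_r
  have ap : ∀ i, a.f i ≫ p.f i = 0 := fun i => by rw [← HomologicalComplex.comp_f, w]; rfl
  have sr : ∀ i, s i ≫ r i = 0 := fun i => (σ i).s_r
  have id' : ∀ i, r i ≫ a.f i + p.f i ≫ s i = 𝟙 _ := fun i => (σ i).id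
  have ra : ∀ i, r i ≫ a.f i = 𝟙 _ - p.f i ≫ s i := fun i => by rw [← id']; abel
  have spd' : ∀ i j {T : 𝒜} (f : M.X j ⟶ T), s i ≫ L.d i j ≫ p.f j ≫ f = M.d i j ≫ f :=
    fun i j T f => by rw [← p.comm_assoc, ← Category.assoc, sp, Category.id_comp]
  let z : Cocycle M N :=
    { h i j := s i ≫ L.d i j ≫ r j
      shape i j hij := by simp [L.shape _ _ hij]
      comm i j l := by
        have : Mono (a.f l) := by
          have := (hx' l).mono_f
          exact this
        rw [← cancel_mono (a.f l)]
        have h₁ : L.d j l ≫ r l ≫ a.f l = L.d j l - L.d j l ≫ p.f l ≫ s l := by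
          rw [ra, Preadditive.comp_sub, Category.comp_id]
        have h₂ : r j ≫ N.d j l ≫ a.f l = L.d j l - p.f j ≫ s j ≫ L.d j l := by
          rw [← a.comm, ← Category.assoc, ra, Preadditive.sub_comp, Category.id_comp,
            Category.assoc]
        simp only [Preadditive.add_comp, Category.assoc]
        rw [h₁, h₂, zero_comp, Preadditive.comp_sub, Preadditive.comp_sub,
          Preadditive.comp_sub, Preadditive.comp_sub, L.d_comp_d, comp_zero, spd', spd',
          M.d_comp_d_assoc, zero_comp]
        abel }
  have ar' : ∀ i {T : 𝒜} (f : N.X i ⟶ T), a.f i ≫ r i ≫ f = f := fun i T f => by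
    rw [← Category.assoc, ar, Category.id_comp]
  have sr' : ∀ i {T : 𝒜} (f : N.X i ⟶ T), s i ≫ r i ≫ f = 0 := fun i T f => by
    rw [← Category.assoc, sr, zero_comp]
  have sp' : ∀ i {T : 𝒜} (f : M.X i ⟶ T), s i ≫ p.f i ≫ f = f := fun i T f => by
    rw [← Category.assoc, sp, Category.id_comp]
  have ap' : ∀ i {T : 𝒜} (f : M.X i ⟶ T), a.f i ≫ p.f i ≫ f = 0 := fun i T f => by
    rw [← Category.assoc, ap, zero_comp]
  let e : z.twist ≅ L := HomologicalComplex.Hom.isoOfComponents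
    (fun i =>
      { hom := z.fst i ≫ a.f i + z.snd i ≫ s i
        inv := r i ≫ z.inl i + p.f i ≫ z.inr i
        hom_inv_id := by
          apply hom_ext <;> apply hom_ext' <;> simp [ar', sp', sr', ap']
        inv_hom_id := by simp [id'] })
    (fun i j _ => by
      apply hom_ext'
      · simp
      · simp [z, ra, spd'])
  refine ⟨z, e, ?_⟩
  apply Subtype.ext
  refine Prod.ext ?_ ?_
  · ext i
    simp [extension, e]
  · ext i
    simp [extension, e]

/-- An equivalence of extensions is in each degree a unipotent triangular matrix; the coboundary of
its off-diagonal entry is the difference of the two cocycles. -/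
lemma extension_rel_iff {L : HomologicalComplex 𝒜 c} (z z' : Cocycle M N) (e : z.twist ≅ L)
    (e' : z'.twist ≅ L) :
    (extensionSetoid M N L).r (z'.extension e') (z.extension e) ↔ ∃ s, z' = z.addδ s := by
  constructor
  · rintro ⟨g, h₁, h₂⟩
    let φ := e' ≪≫ g ≪≫ e.symm
    have h₁ : z'.inclusion ≫ φ.hom = z.inclusion := by
      have := congrArg (fun t => t ≫ e.inv) h₁
      simpa [extension, φ] using this
    have h₂ : φ.hom ≫ z.projection = z'.projection := by
      have := congrArg (fun t => e'.hom ≫ t) h₂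
      simpa [extension, φ] using this
    have h₁ (i : ι) : z'.inl i ≫ φ.hom.f i = z.inl i := by
      simpa using congrArg (fun t => t.f i) h₁
    have h₂ (i : ι) : φ.hom.f i ≫ z.snd i = z'.snd i := by
      simpa using congrArg (fun t => t.f i) h₂
    refine ⟨fun i => z'.inr i ≫ φ.hom.f i ≫ z.fst i, ?_⟩
    ext i j
    -- The entry from `M` to `N` of the compatibility of `φ` with the differentials.
    have : z'.inr i ≫ φ.hom.f i ≫ z.twist.d i j ≫ z.fst j =
        z'.inr i ≫ z'.twist.d i j ≫ φ.hom.f j ≫ z.fst j := by rw [φ.hom.comm_assoc]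
    have h₂' := reassoc_of% (h₂ i)
    have h₁' := reassoc_of% (h₁ j)
    simp only [twist_d_fst, Preadditive.comp_add, h₂', inr_snd_assoc, inr_twist_d_assoc, h₁',
      inl_fst, Category.comp_id] at this
    simp only [addδ_h, Pi.add_apply, δ_apply, Category.assoc]
    rw [add_sub, add_comm, this]
    abel
  · rintro ⟨s, rfl⟩
    refine ⟨e'.symm ≪≫ z.twistAddδ s ≪≫ e, ?_, ?_⟩
    · have := z.inclusion_twistAddδ s
      simp [extension, reassoc_of% this]
    · have := z.twistAddδ_projection s
      simp [extension, this]

/-- The kernel of the coboundary map consists of the morphisms of complexes. -/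
def kerδEquiv (M N : HomologicalComplex 𝒜 c) : (δ M N).ker ≃ (M ⟶ N) where
  toFun s := { f := s.1, comm' i j _ := by
                  have := congrFun (congrFun s.2 i) j
                  exact sub_eq_zero.1 this }
  invFun f := ⟨f.f, by ext i j; simp [δ_apply]⟩
  left_inv _ := rfl
  right_inv _ := rfl

/-- The class of the extension defined by a cocycle. -/
def extClass {L : HomologicalComplex 𝒜 c} (z : {z : Cocycle M N // Nonempty (z.twist ≅ L)}) :
    ExtMiddle M N L :=
  Quotient.mk (extensionSetoid M N L) (z.1.extension z.2.some)

lemma extClass_surjective [∀ i, Projective (M.X i)] (L : HomologicalComplex 𝒜 c) :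
    Function.Surjective (extClass (M := M) (N := N) (L := L)) := by
  intro q
  induction q using Quotient.inductionOn with | _ x
  obtain ⟨z, e, rfl⟩ := exists_extension_eq x
  -- The isomorphism chosen in `extClass` may differ from `e`; taking `s = 0` shows that the class
  -- does not depend on it.
  refine ⟨⟨z, ⟨e⟩⟩, Quotient.sound ((extension_rel_iff _ _ _ _).2 ⟨0, ?_⟩)⟩
  ext
  simp

lemma extClass_eq_iff {L : HomologicalComplex 𝒜 c}
    (z z' : {z : Cocycle M N // Nonempty (z.twist ≅ L)}) :
    extClass z' = extClass z ↔ ∃ s, z'.1 = z.1.addδ s := by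
  exact ⟨fun h => (extension_rel_iff _ _ _ _).1 (Quotient.exact h),
    fun h => Quotient.sound ((extension_rel_iff _ _ _ _).2 h)⟩

/-- The cocycles with a given extension class form a torsor under the coboundaries. -/
def fiberEquiv {L : HomologicalComplex 𝒜 c} (z : {z : Cocycle M N // Nonempty (z.twist ≅ L)}) :
    {z' : {z : Cocycle M N // Nonempty (z.twist ≅ L)} // extClass z' = extClass z} ≃
      (δ M N).range where
  toFun z' := ⟨z'.1.1.h - z.1.h, by
    obtain ⟨s, hs⟩ := (extClass_eq_iff _ _).1 z'.2
    exact ⟨s, by rw [hs]; exact (add_sub_cancel_left _ _).symm⟩⟩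
  invFun b := ⟨⟨z.1.addδ b.2.choose, ⟨z.1.twistAddδ _ ≪≫ z.2.some⟩⟩,
    (extClass_eq_iff _ _).2 ⟨_, rfl⟩⟩
  left_inv z' := by
    apply Subtype.ext
    apply Subtype.ext
    apply Cocycle.ext
    have hb : z'.1.1.h - z.1.h ∈ (δ M N).range := by
      obtain ⟨s, hs⟩ := (extClass_eq_iff _ _).1 z'.2
      exact ⟨s, by rw [hs]; exact (add_sub_cancel_left _ _).symm⟩
    change z.1.h + δ M N hb.choose = _
    rw [hb.choose_spec]
    abel
  right_inv b := by
    apply Subtype.ext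
    change z.1.h + δ M N b.2.choose - z.1.h = _
    rw [b.2.choose_spec]
    abel

/-- Each extension class is represented by as many cocycles as there are coboundaries, and the
coboundaries are the degreewise families modulo the morphisms of complexes. Thus |Ext¹_L| / |Hom| is
the number of cocycles with twist `L` divided by the number of degreewise families. -/
theorem card_extMiddle_mul [∀ i, Projective (M.X i)] (L : HomologicalComplex 𝒜 c) :
    Nat.card (ExtMiddle M N L) * Nat.card (∀ i, M.X i ⟶ N.X i) =
      Nat.card {z : Cocycle M N // Nonempty (z.twist ≅ L)} * Nat.card (M ⟶ N) := by
  have e : {z : Cocycle M N // Nonempty (z.twist ≅ L)} ≃ ExtMiddle M N L × (δ M N).range := by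
    refine (Equiv.sigmaFiberEquiv (extClass (M := M) (N := N) (L := L))).symm.trans
      ((Equiv.sigmaCongrRight fun q => ?_).trans (Equiv.sigmaEquivProd _ _))
    refine (Equiv.subtypeEquivRight fun z => ?_).trans (fiberEquiv (extClass_surjective L q).choose)
    rw [(extClass_surjective L q).choose_spec]
  rw [Nat.card_congr e, Nat.card_prod, ← Nat.card_congr (kerδEquiv M N),
    ← (δ M N).ker.card_mul_index, AddSubgroup.index_ker]
  ring

end Cocycle

end Extensions

/-! ### The Hall product in terms of cocycles -/

section RootCard

/-- The complex square root of a natural number. -/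
def rootNat (n : ℕ) : ℂ := ((Real.sqrt n : ℝ) : ℂ)

lemma rootNat_mul (m n : ℕ) : rootNat (m * n) = rootNat m * rootNat n := by
  simp [rootNat]

lemma rootNat_mul_self (n : ℕ) : rootNat n * rootNat n = n := by
  rw [rootNat, ← Complex.ofReal_mul, Real.mul_self_sqrt (Nat.cast_nonneg n)]
  simp

@[simp]
lemma rootNat_one : rootNat 1 = 1 := by simp [rootNat]

lemma rootNat_ne_zero {n : ℕ} (hn : n ≠ 0) : rootNat n ≠ 0 := by
  simpa [rootNat] using hn

lemma rootNat_card_ne_zero (α : Type*) [Finite α] [Nonempty α] : rootNat (Nat.card α) ≠ 0 :=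
  rootNat_ne_zero Nat.card_pos.ne'

end RootCard

section Euler

variable (k : Type*) [Field k] {𝒜 : Type u} [Category.{v} 𝒜] [Abelian 𝒜] [Linear k 𝒜]

lemma IsFinitary.finite_homs {k : Type*} [Field k] [Finite k] {𝒜 : Type u} [Category.{v} 𝒜]
    [Abelian 𝒜] [Linear k 𝒜] (hfin : IsFinitary k 𝒜) (X Y : 𝒜) : Finite (X ⟶ Y) := by
  have := hfin.finite_hom X Y
  exact Module.finite_of_finite k

lemma vParam_ne_zero [Finite k] : vParam k ≠ 0 := rootNat_card_ne_zero k

lemma eulerForm_of_projective (P Y : 𝒜) [Projective P] :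
    eulerForm k P Y = Module.finrank k (P ⟶ Y) := by
  let := HasExt.standard 𝒜
  rw [eulerForm, finsum_eq_single _ 0]
  · rw [pow_zero, one_mul, extDim, (Abelian.Ext.linearEquiv₀ (R := k)).finrank_eq]
  · intro i hi
    have : Subsingleton (Abelian.Ext.{max u v} P Y i) :=
      HasProjectiveDimensionLT.subsingleton P 1 i (Nat.one_le_iff_ne_zero.2 hi) Y
    rw [extDim, Module.finrank_zero_of_subsingleton]
    simp

/-- The Euler form reduces to dim Hom(P, Y), and q to this power is |Hom(P, Y)|. -/
lemma vParam_zpow_eulerForm [Finite k] [∀ X Y : 𝒜, Finite (X ⟶ Y)] (P Y : 𝒜) [Projective P] :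
    vParam k ^ eulerForm k P Y = rootNat (Nat.card (P ⟶ Y)) := by
  rw [eulerForm_of_projective, zpow_natCast, Module.natCard_eq_pow_finrank (K := k), vParam]
  induction Module.finrank k (P ⟶ Y) with
  | zero => simp
  | succ n ih => rw [pow_succ, ih, pow_succ, rootNat_mul]; rfl

end Euler

section Product

variable {𝒜 : Type u} [Category.{v} 𝒜] [Abelian 𝒜]

instance (X : C₂P 𝒜) (i : ZMod 2) : Projective (X.obj.X i) := X.property i

/-- The extension defined by a cocycle, as an object of `C₂(𝒫)`. -/
def twistP {M N : C₂P 𝒜} (z : Cocycle M.obj N.obj) : C₂P 𝒜 :=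
  ⟨z.twist, fun i => z.twist_projective i⟩

lemma isoClass_eq_iff {X Y : C₂P 𝒜} : isoClass X = isoClass Y ↔ Nonempty (X.obj ≅ Y.obj) := by
  rw [Quotient.eq]
  exact ⟨fun ⟨e⟩ => ⟨(isProjectiveComplex 𝒜).ι.mapIso e⟩,
    fun ⟨e⟩ => ⟨(isProjectiveComplex 𝒜).fullyFaithfulι.preimageIso e⟩⟩

/-- An isomorphism from the representative of an isomorphism class. -/
def outIso (X : C₂P 𝒜) : (isoClass X).out.obj ≅ X.obj :=
  (isoClass_eq_iff.1 (Quotient.out_eq (isoClass X))).some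

/-- The degree zero part of the Hom-complex. -/
abbrev DegHom (M N : C₂ 𝒜) : Type v := ∀ i, M.X i ⟶ N.X i

lemma card_degHom_congr {M M' N N' : C₂ 𝒜} (e : M ≅ M') (e' : N ≅ N') :
    Nat.card (DegHom M N) = Nat.card (DegHom M' N') :=
  Nat.card_congr (Equiv.piCongrRight fun i =>
    Iso.homCongr ((HomologicalComplex.eval 𝒜 _ i).mapIso e)
      ((HomologicalComplex.eval 𝒜 _ i).mapIso e'))

lemma card_degHom_twist_left {A B C : C₂ 𝒜} (z : Cocycle A B) :
    Nat.card (DegHom z.twist C) = Nat.card (DegHom A C) * Nat.card (DegHom B C) := by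
  rw [← Nat.card_prod]
  exact Nat.card_congr
    { toFun s := (fun i => z.inr i ≫ s i, fun i => z.inl i ≫ s i)
      invFun s i := z.fst i ≫ s.2 i + z.snd i ≫ s.1 i
      left_inv s := by ext i; apply z.hom_ext' <;> simp
      right_inv s := by ext i <;> simp }

lemma card_degHom_twist_right {A B C : C₂ 𝒜} (z : Cocycle B C) :
    Nat.card (DegHom A z.twist) = Nat.card (DegHom A B) * Nat.card (DegHom A C) := by
  rw [← Nat.card_prod]
  exact Nat.card_congr
    { toFun s := (fun i => s i ≫ z.snd i, fun i => s i ≫ z.fst i)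
      invFun s i := s.2 i ≫ z.inl i + s.1 i ≫ z.inr i
      left_inv s := by ext i; apply z.hom_ext <;> simp
      right_inv s := by ext i <;> simp }

lemma card_degHom (M N : C₂ 𝒜) :
    Nat.card (DegHom M N) = Nat.card (M.X 0 ⟶ N.X 0) * Nat.card (M.X 1 ⟶ N.X 1) := by
  rw [← Nat.card_prod]
  exact Nat.card_congr (piFinTwoEquiv fun i : ZMod 2 => (M.X i ⟶ N.X i))

variable [∀ X Y : 𝒜, Finite (X ⟶ Y)]

instance (M N : C₂ 𝒜) : Fintype (Cocycle M N) := Fintype.ofFinite _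

/-- The value of a linear functional on the product of two classes in the Hall algebra. -/
def hallSum (M N : C₂P 𝒜) (f : IsoClass (C₂P 𝒜) → ℂ) : ℂ :=
  (rootNat (Nat.card (DegHom M.obj N.obj)))⁻¹ *
    ∑ z : Cocycle M.obj N.obj, f (isoClass (twistP z))

lemma hallSum_congr {M M' N N' : C₂P 𝒜} (e : M.obj ≅ M'.obj) (e' : N.obj ≅ N'.obj)
    (f : IsoClass (C₂P 𝒜) → ℂ) : hallSum M N f = hallSum M' N' f := by
  rw [hallSum, hallSum, card_degHom_congr e e']
  congr 1
  refine Fintype.sum_equiv (Cocycle.congrEquiv e e') _ _ fun z => congrArg f ?_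
  exact isoClass_eq_iff.2 ⟨z.twistCongr e e'⟩

/-- The right multiplication by `[N]`, acting on linear functionals on the Hall algebra. -/
def act (N : C₂P 𝒜) : Module.End ℂ (IsoClass (C₂P 𝒜) → ℂ) where
  toFun f a := hallSum a.out N f
  map_add' f g := by ext; simp [hallSum, Finset.sum_add_distrib, mul_add]
  map_smul' r f := by ext; simp [hallSum, ← Finset.mul_sum]; ring

lemma act_apply (N X : C₂P 𝒜) (f : IsoClass (C₂P 𝒜) → ℂ) :
    act N f (isoClass X) = hallSum X N f :=
  hallSum_congr (outIso X) (Iso.refl _) f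

lemma act_congr {N N' : C₂P 𝒜} (e : N.obj ≅ N'.obj) : act N = act N' := by
  ext f a
  exact hallSum_congr (Iso.refl _) e f

/-- This is associativity of the Hall product: the left side at `X` is f(([X] * [N]) * [N']).
`Cocycle.assocEquiv` matches the sums, and the normalizing factors agree because degreewise families
are counted multiplicatively on twists. -/
lemma act_mul_act (N N' : C₂P 𝒜) :
    act N * act N' = (rootNat (Nat.card (DegHom N.obj N'.obj)))⁻¹ •
      ∑ z : Cocycle N.obj N'.obj, act (twistP z) := by
  ext f a
  induction a using Quotient.inductionOn with | _ X
  change act N (act N' f) (isoClass X) = _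
  simp only [LinearMap.smul_apply, LinearMap.sum_apply, Pi.smul_apply, Finset.sum_apply,
    smul_eq_mul]
  change _ = _ * ∑ z : Cocycle N.obj N'.obj, act (twistP z) f (isoClass X)
  simp only [act_apply, hallSum]
  have h₁ (z : Cocycle X.obj N.obj) : Nat.card (DegHom (twistP z).obj N'.obj) =
    Nat.card (DegHom X.obj N'.obj) * Nat.card (DegHom N.obj N'.obj) := card_degHom_twist_left z
  have h₂ (z : Cocycle N.obj N'.obj) : Nat.card (DegHom X.obj (twistP z).obj) =
    Nat.card (DegHom X.obj N.obj) * Nat.card (DegHom X.obj N'.obj) := card_degHom_twist_right z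
  simp only [h₁, h₂, ← Finset.mul_sum, rootNat_mul, mul_inv]
  have : ∑ z : Cocycle X.obj N.obj, ∑ w : Cocycle (twistP z).obj N'.obj, f (isoClass (twistP w)) =
      ∑ z : Cocycle N.obj N'.obj, ∑ w : Cocycle X.obj (twistP z).obj, f (isoClass (twistP w)) := by
    rw [← Fintype.sum_sigma', ← Fintype.sum_sigma']
    refine Fintype.sum_equiv (Cocycle.assocEquiv _ _ _) _ _ fun z => congrArg f ?_
    exact isoClass_eq_iff.2 ⟨Cocycle.twistAssoc z.2⟩
  rw [this]
  ring

-- The Euler twist contributes the square root of the number of degreewise families, while counting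
-- extensions by cocycles divides by that number itself; the inverse square root remains.
open Classical in
lemma twistedHallProduct_eq (k : Type*) [Field k] [Finite k] [Linear k 𝒜]
    (a b : IsoClass (C₂P 𝒜)) :
    twistedHallProduct (fun c : IsoClass (C₂P 𝒜) => c.out.obj)
      (fun M N => vParam k ^ (eulerForm k (M.X 0) (N.X 0) + eulerForm k (M.X 1) (N.X 1))) a b =
    (rootNat (Nat.card (DegHom a.out.obj b.out.obj)))⁻¹ •
      ∑ z : Cocycle a.out.obj b.out.obj, Finsupp.single (isoClass (twistP z)) (1 : ℂ) := by
  have key (c : IsoClass (C₂P 𝒜)) :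
      vParam k ^ (eulerForm k (a.out.obj.X 0) (b.out.obj.X 0) +
        eulerForm k (a.out.obj.X 1) (b.out.obj.X 1)) *
          hallNumber a.out.obj b.out.obj c.out.obj =
      (rootNat (Nat.card (DegHom a.out.obj b.out.obj)))⁻¹ *
        (Finset.univ.filter fun z : Cocycle a.out.obj b.out.obj =>
          isoClass (twistP z) = c).card := by
    have hc := Cocycle.card_extMiddle_mul (M := a.out.obj) (N := b.out.obj) c.out.obj
    have hf : Nat.card {z : Cocycle a.out.obj b.out.obj // Nonempty (z.twist ≅ c.out.obj)} =
        (Finset.univ.filter fun z : Cocycle a.out.obj b.out.obj =>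
          isoClass (twistP z) = c).card := by
      rw [Nat.card_eq_fintype_card, Fintype.card_subtype]
      congr 1
      ext z
      simp only [Finset.mem_filter, Finset.mem_univ, true_and]
      conv_rhs => rw [← Quotient.out_eq c]
      exact (isoClass_eq_iff (X := twistP z) (Y := c.out)).symm
    rw [hf] at hc
    rw [zpow_add₀ (vParam_ne_zero k), vParam_zpow_eulerForm, vParam_zpow_eulerForm, ← rootNat_mul,
      ← card_degHom, hallNumber]
    have h₁ := rootNat_card_ne_zero (DegHom a.out.obj b.out.obj)
    have h₂ := rootNat_mul_self (Nat.card (DegHom a.out.obj b.out.obj))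
    have : Finite (a.out.obj ⟶ b.out.obj) :=
      Finite.of_injective (fun f : a.out.obj ⟶ b.out.obj => f.f)
        fun _ _ h => HomologicalComplex.hom_ext _ _ fun i => congrFun h i
    have h₃ : (Nat.card (a.out.obj ⟶ b.out.obj) : ℂ) ≠ 0 :=
      Nat.cast_ne_zero.2 Nat.card_pos.ne'
    field_simp
    rw [sq, h₂]
    have hc' := congrArg (Nat.cast : ℕ → ℂ) hc
    push_cast at hc'
    linear_combination hc'
  simp only [twistedHallProduct, key]
  -- Only classes of twists contribute, so the sum is finite; the cocycles are then grouped by the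
  -- class of their twist.
  rw [finsum_eq_sum_of_support_subset (s := Finset.univ.image fun z :
    Cocycle a.out.obj b.out.obj => isoClass (twistP z)), Finset.smul_sum,
    ← Finset.sum_fiberwise_of_maps_to (g := fun z => isoClass (twistP z))
      (fun z _ => Finset.mem_image_of_mem (fun z => isoClass (twistP z)) (Finset.mem_univ z))]
  · refine Finset.sum_congr rfl fun c _ => ?_
    rw [Finset.sum_congr rfl (g := fun _ => (rootNat (Nat.card
      (DegHom a.out.obj b.out.obj)))⁻¹ • Finsupp.single c (1 : ℂ))
      (fun z hz => by rw [(Finset.mem_filter.1 hz).2]), Finset.sum_const]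
    ext d
    simp [Finsupp.single_apply]
    split_ifs <;> ring
  · intro c hc
    by_contra h
    apply hc
    have : (Finset.univ.filter fun z : Cocycle a.out.obj b.out.obj =>
        isoClass (twistP z) = c) = ∅ := by
      ext z
      simp only [Finset.mem_filter, Finset.mem_univ, true_and, Finset.notMem_empty, iff_false]
      rintro rfl
      exact h (by simp)
    simp [this]

end Product

/-! ### Extensions by disk complexes -/

section Disks

variable {𝒜 : Type u} [Category.{v} 𝒜] [Abelian 𝒜]

lemma isIso_diskComplex_d (a : ZMod 2) (P : 𝒜) : IsIso ((diskComplex a P).d a (a + 1)) := by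
  have : (diskComplex a P).d a (a + 1) = 𝟙 P := by simp [diskComplex]
  rw [this]
  exact inferInstanceAs (IsIso (𝟙 P))

lemma zmod_two_cases (a i : ZMod 2) : i = a ∨ i = a + 1 := by
  revert a i; decide

lemma zmod_two_add_one_add_one (a : ZMod 2) : a + 1 + 1 = a := by
  revert a; decide

lemma zmod_two_add_one_ne (a : ZMod 2) : a + 1 ≠ a := by
  revert a; decide

/-- Cocycles on the two-cyclic complexes are determined by the values `h i (i + 1)`. -/
lemma Cocycle.ext_zmod_two {M N : C₂ 𝒜} {z w : Cocycle M N} (a : ZMod 2)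
    (h₁ : z.h a (a + 1) = w.h a (a + 1)) (h₂ : z.h (a + 1) a = w.h (a + 1) a) : z = w := by
  ext i j
  by_cases hij : i + 1 = j
  · subst hij
    rcases zmod_two_cases a i with rfl | rfl
    · exact h₁
    · rw [zmod_two_add_one_add_one]
      exact h₂
  · rw [z.shape _ _ hij, w.shape _ _ hij]

lemma Cocycle.zero_addδ_h {M N : C₂ 𝒜} (s : ∀ i, M.X i ⟶ N.X i) (i j : ZMod 2) :
    ((Cocycle.zero M N).addδ s).h i j = s i ≫ N.d i j - M.d i j ≫ s j := by
  simp [δ_apply]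

/-- Since the differential is invertible, the component of a cocycle from `a` to `a + 1` determines
`g`, and the cocycle condition forces the other component. So all these extensions split, and the
cocycles are counted by a single Hom-space. -/
lemma bijective_cocycle_of_isIso (a : ZMod 2) (D X : C₂ 𝒜) [IsIso (D.d a (a + 1))] :
    Function.Bijective fun g : D.X (a + 1) ⟶ X.X (a + 1) =>
      (Cocycle.zero D X).addδ (Pi.single (a + 1) g) := by
  have h₁ (g : D.X (a + 1) ⟶ X.X (a + 1)) : ((Cocycle.zero D X).addδ
      (Pi.single (a + 1) g)).h a (a + 1) = -(D.d a (a + 1) ≫ g) := by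
    rw [Cocycle.zero_addδ_h]
    simp [(zmod_two_add_one_ne a).symm]
  have h₂ (g : D.X (a + 1) ⟶ X.X (a + 1)) : ((Cocycle.zero D X).addδ
      (Pi.single (a + 1) g)).h (a + 1) a = g ≫ X.d (a + 1) a := by
    rw [Cocycle.zero_addδ_h]
    simp [(zmod_two_add_one_ne a).symm]
  constructor
  · intro g g' h
    have := congrArg (fun z => Cocycle.h z a (a + 1)) h
    dsimp only at this
    rwa [h₁, h₁, neg_inj, cancel_epi] at this
  · intro z
    refine ⟨-(inv (D.d a (a + 1)) ≫ z.h a (a + 1)), Cocycle.ext_zmod_two a ?_ ?_⟩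
    · rw [h₁]
      simp
    · rw [h₂, ← cancel_epi (D.d a (a + 1)), eq_comm, ← sub_eq_zero, ← z.comm a (a + 1) a]
      simp

/-- Dual to `bijective_cocycle_of_isIso`; the homotopy now sits in degree `a`, the source of the
invertible differential. -/
lemma bijective_cocycle_to_isIso (a : ZMod 2) (D X : C₂ 𝒜) [IsIso (D.d a (a + 1))] :
    Function.Bijective fun g : X.X a ⟶ D.X a =>
      (Cocycle.zero X D).addδ (Pi.single a g) := by
  have h₁ (g : X.X a ⟶ D.X a) : ((Cocycle.zero X D).addδ
      (Pi.single a g)).h a (a + 1) = g ≫ D.d a (a + 1) := by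
    rw [Cocycle.zero_addδ_h]
    simp [zmod_two_add_one_ne a]
  have h₂ (g : X.X a ⟶ D.X a) : ((Cocycle.zero X D).addδ
      (Pi.single a g)).h (a + 1) a = -(X.d (a + 1) a ≫ g) := by
    rw [Cocycle.zero_addδ_h]
    simp [zmod_two_add_one_ne a]
  constructor
  · intro g g' h
    have := congrArg (fun z => Cocycle.h z a (a + 1)) h
    dsimp only at this
    rwa [h₁, h₁, cancel_mono] at this
  · intro z
    refine ⟨z.h a (a + 1) ≫ inv (D.d a (a + 1)), Cocycle.ext_zmod_two a ?_ ?_⟩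
    · rw [h₁]
      simp
    · rw [h₂, ← cancel_mono (D.d a (a + 1)), eq_comm, ← sub_eq_zero, ← z.comm (a + 1) a (a + 1)]
      simp [add_comm]

/-- Direct sums do not depend on the order of the summands. -/
def sumComm (M N : C₂ 𝒜) : (Cocycle.zero M N).twist ≅ (Cocycle.zero N M).twist :=
  HomologicalComplex.Hom.isoOfComponents
    (fun i =>
      { hom := (Cocycle.zero M N).fst i ≫ (Cocycle.zero N M).inr i +
          (Cocycle.zero M N).snd i ≫ (Cocycle.zero N M).inl i
        inv := (Cocycle.zero N M).fst i ≫ (Cocycle.zero M N).inr i +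
          (Cocycle.zero N M).snd i ≫ (Cocycle.zero M N).inl i
        hom_inv_id := by apply Cocycle.hom_ext <;> apply Cocycle.hom_ext' <;> simp
        inv_hom_id := by apply Cocycle.hom_ext <;> apply Cocycle.hom_ext' <;> simp })
    (fun i j _ => by
      apply Cocycle.hom_ext <;> apply Cocycle.hom_ext' <;> simp)

/-- The direct sum in `C₂(𝒫)`. -/
def sumP (M N : C₂P 𝒜) : C₂P 𝒜 := twistP (Cocycle.zero M.obj N.obj)

lemma isoClass_sumP_comm (M N : C₂P 𝒜) : isoClass (sumP M N) = isoClass (sumP N M) :=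
  isoClass_eq_iff.2 ⟨sumComm M.obj N.obj⟩

/-- The disk complexes with projective components. -/
def diskP (a : ZMod 2) (P : 𝒜) [hP : Projective P] : C₂P 𝒜 := ⟨diskComplex a P, fun _ => hP⟩

lemma card_degHom_add_one (a : ZMod 2) (M N : C₂ 𝒜) :
    Nat.card (DegHom M N) =
      Nat.card (M.X a ⟶ N.X a) * Nat.card (M.X (a + 1) ⟶ N.X (a + 1)) := by
  rw [card_degHom]
  have : a = 0 ∨ a = 1 := by revert a; decide
  rcases this with rfl | rfl
  · rfl
  · exact mul_comm _ _

/-- The square root of the number of morphisms. -/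
def rootHom (X Y : 𝒜) : ℂ := rootNat (Nat.card (X ⟶ Y))

lemma rootHom_congr {𝒞 : Type*} [Category 𝒞] {X X' Y Y' : 𝒞} (e : X ≅ X')
    (e' : Y ≅ Y') : rootHom X Y = rootHom X' Y' := by
  rw [rootHom, rootHom, Nat.card_congr (Iso.homCongr e e')]

lemma rootHom_twist_left {M N : C₂ 𝒜} (z : Cocycle M N) (i : ZMod 2) (Y : 𝒜) :
    rootHom (z.twist.X i) Y = rootHom (N.X i) Y * rootHom (M.X i) Y := by
  rw [rootHom, rootHom, rootHom, ← rootNat_mul, ← Nat.card_prod]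
  congr 1
  exact Nat.card_congr
    { toFun s := (z.inl i ≫ s, z.inr i ≫ s)
      invFun s := z.fst i ≫ s.1 + z.snd i ≫ s.2
      left_inv s := by apply z.hom_ext' <;> simp
      right_inv s := by ext <;> simp }

lemma rootHom_twist_right {M N : C₂ 𝒜} (z : Cocycle M N) (i : ZMod 2) (Y : 𝒜) :
    rootHom Y (z.twist.X i) = rootHom Y (N.X i) * rootHom Y (M.X i) := by
  rw [rootHom, rootHom, rootHom, ← rootNat_mul, ← Nat.card_prod]
  congr 1
  exact Nat.card_congr
    { toFun s := (s ≫ z.fst i, s ≫ z.snd i)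
      invFun s := s.1 ≫ z.inl i + s.2 ≫ z.inr i
      left_inv s := by apply z.hom_ext <;> simp
      right_inv s := by ext <;> simp }

/-- The scalar by which the class of a disk complex acts on invariant functionals. -/
def diskScalar (a : ZMod 2) (P : 𝒜) (X : C₂P 𝒜) : ℂ :=
  rootHom (X.obj.X a) P * rootHom P (X.obj.X a) /
    (rootHom (X.obj.X (a + 1)) P * rootHom P (X.obj.X (a + 1)))

lemma diskScalar_congr (a : ZMod 2) (P : 𝒜) {X Y : C₂P 𝒜} (e : X.obj ≅ Y.obj) :
    diskScalar a P X = diskScalar a P Y := by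
  have h (i : ZMod 2) : X.obj.X i ≅ Y.obj.X i := (HomologicalComplex.eval 𝒜 _ i).mapIso e
  rw [diskScalar, diskScalar, rootHom_congr (h a) (Iso.refl P), rootHom_congr (Iso.refl P) (h a),
    rootHom_congr (h (a + 1)) (Iso.refl P), rootHom_congr (Iso.refl P) (h (a + 1))]

variable [∀ X Y : 𝒜, Finite (X ⟶ Y)]

lemma rootHom_ne_zero (X Y : 𝒜) : rootHom X Y ≠ 0 := rootNat_card_ne_zero _

lemma sum_cocycle_eq {α : Type*} [Finite α] {M N : C₂P 𝒜} {s : α → DegHom M.obj N.obj}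
    (hs : Function.Bijective fun x => (Cocycle.zero M.obj N.obj).addδ (s x))
    (f : IsoClass (C₂P 𝒜) → ℂ) :
    ∑ z : Cocycle M.obj N.obj, f (isoClass (twistP z)) =
      Nat.card α * f (isoClass (sumP M N)) := by
  rw [Finset.sum_congr rfl (g := fun _ => f (isoClass (sumP M N))), Finset.sum_const,
    Nat.card_congr (Equiv.ofBijective _ hs), nsmul_eq_mul, Nat.card_eq_fintype_card]
  · rfl
  · intro z _
    obtain ⟨x, rfl⟩ := hs.2 z
    exact congrArg f (isoClass_eq_iff.2 ⟨(Cocycle.zero M.obj N.obj).twistAddδ (s x)⟩)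

/-- There are |Hom(P, X_{a+1})| cocycles, all with split twist, and the normalization is the root of
|Hom(P, X_a)| · |Hom(P, X_{a+1})|. -/
lemma hallSum_disk_left (a : ZMod 2) (P : 𝒜) [Projective P] (X : C₂P 𝒜)
    (f : IsoClass (C₂P 𝒜) → ℂ) :
    hallSum (diskP a P) X f = rootHom P (X.obj.X (a + 1)) / rootHom P (X.obj.X a) *
      f (isoClass (sumP (diskP a P) X)) := by
  have := isIso_diskComplex_d a P
  rw [hallSum, sum_cocycle_eq (M := diskP a P) (bijective_cocycle_of_isIso a (diskComplex a P) X.obj),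
    card_degHom_add_one a, rootNat_mul, ← rootNat_mul_self]
  have h₁ := rootHom_ne_zero P (X.obj.X a)
  have h₂ := rootHom_ne_zero P (X.obj.X (a + 1))
  change (rootHom P (X.obj.X a) * rootHom P (X.obj.X (a + 1)))⁻¹ *
    (rootHom P (X.obj.X (a + 1)) * rootHom P (X.obj.X (a + 1)) * _) = _
  field_simp

lemma hallSum_disk_right (a : ZMod 2) (P : 𝒜) [Projective P] (X : C₂P 𝒜)
    (f : IsoClass (C₂P 𝒜) → ℂ) :
    hallSum X (diskP a P) f = rootHom (X.obj.X a) P / rootHom (X.obj.X (a + 1)) P *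
      f (isoClass (sumP (diskP a P) X)) := by
  have := isIso_diskComplex_d a P
  rw [hallSum, sum_cocycle_eq (N := diskP a P) (bijective_cocycle_to_isIso a (diskComplex a P) X.obj),
    card_degHom_add_one a, rootNat_mul, ← rootNat_mul_self, isoClass_sumP_comm]
  have h₁ := rootHom_ne_zero (X.obj.X a) P
  have h₂ := rootHom_ne_zero (X.obj.X (a + 1)) P
  change (rootHom (X.obj.X a) P * rootHom (X.obj.X (a + 1)) P)⁻¹ *
    (rootHom (X.obj.X a) P * rootHom (X.obj.X a) P * _) = _
  field_simp

/-! ### The module of invariant functionals -/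

variable (𝒜) in
/-- The linear functionals on the Hall algebra which are invariant under left multiplication by
the classes of the disk complexes. -/
def invariants : Submodule ℂ (IsoClass (C₂P 𝒜) → ℂ) where
  carrier := {f | ∀ (a : ZMod 2) (P : 𝒜) [Projective P] (X : C₂P 𝒜),
    act X f (isoClass (diskP a P)) = f (isoClass X)}
  add_mem' hf hg a P _ X := by
    rw [map_add, Pi.add_apply, Pi.add_apply, hf, hg]
  zero_mem' a P _ X := by simp
  smul_mem' r f hf a P _ X := by
    rw [map_smul, Pi.smul_apply, Pi.smul_apply, hf]

lemma mem_invariants_iff {f : IsoClass (C₂P 𝒜) → ℂ} :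
    f ∈ invariants 𝒜 ↔ ∀ (a : ZMod 2) (P : 𝒜) [Projective P] (X : C₂P 𝒜),
      rootHom P (X.obj.X (a + 1)) / rootHom P (X.obj.X a) *
        f (isoClass (sumP (diskP a P) X)) = f (isoClass X) := by
  simp only [← hallSum_disk_left, ← act_apply]
  rfl

/-- Left and right multiplication commute: f([K] * ([X] * [N])) = f([X] * [N]), applied to each term
of [X] * [N]. -/
lemma act_mem_invariants (N : C₂P 𝒜) {f : IsoClass (C₂P 𝒜) → ℂ} (hf : f ∈ invariants 𝒜) :
    act N f ∈ invariants 𝒜 := by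
  intro a P _ X
  change (act X * act N) f _ = _
  rw [act_mul_act, act_apply, hallSum]
  simp only [LinearMap.smul_apply, LinearMap.sum_apply, Pi.smul_apply, Finset.sum_apply,
    smul_eq_mul]
  congr 1
  exact Finset.sum_congr rfl fun z _ => hf a P (twistP z)

/-- The action of the class of `N` on the invariant functionals. -/
def actInv (N : C₂P 𝒜) : Module.End ℂ (invariants 𝒜) :=
  (act N).restrict fun _ hf => act_mem_invariants N hf

lemma actInv_apply (N X : C₂P 𝒜) (f : invariants 𝒜) :
    (actInv N f).1 (isoClass X) = hallSum X N f.1 := act_apply N X f.1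

lemma actInv_congr {N N' : C₂P 𝒜} (e : N.obj ≅ N'.obj) : actInv N = actInv N' := by
  ext f : 2
  exact congrArg (fun φ : Module.End ℂ _ => φ f.1) (act_congr e)

lemma actInv_mul_actInv (N N' : C₂P 𝒜) :
    actInv N * actInv N' = (rootNat (Nat.card (DegHom N.obj N'.obj)))⁻¹ •
      ∑ z : Cocycle N.obj N'.obj, actInv (twistP z) := by
  ext f : 2
  have := congrArg (fun φ : Module.End ℂ _ => φ f.1) (act_mul_act N N')
  refine Eq.trans this ?_
  simp only [LinearMap.smul_apply, LinearMap.sum_apply, Submodule.coe_smul, Submodule.coe_sum]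
  rfl

lemma diskScalar_ne_zero (a : ZMod 2) (P : 𝒜) (X : C₂P 𝒜) : diskScalar a P X ≠ 0 :=
  div_ne_zero (mul_ne_zero (rootHom_ne_zero _ _) (rootHom_ne_zero _ _))
    (mul_ne_zero (rootHom_ne_zero _ _) (rootHom_ne_zero _ _))

/-- A disk has the same object in both degrees, so its contribution cancels. This makes division by
the scalar preserve invariance. -/
lemma diskScalar_sumP_disk (a b : ZMod 2) (P Q : 𝒜) [Projective Q] (X : C₂P 𝒜) :
    diskScalar a P (sumP (diskP b Q) X) = diskScalar a P X := by
  simp only [diskScalar, sumP, twistP, rootHom_twist_left, rootHom_twist_right]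
  have h₁ := rootHom_ne_zero P Q
  have h₂ := rootHom_ne_zero Q P
  change (rootHom (X.obj.X a) P * rootHom Q P) * (rootHom P (X.obj.X a) * rootHom P Q) /
    ((rootHom (X.obj.X (a + 1)) P * rootHom Q P) *
      (rootHom P (X.obj.X (a + 1)) * rootHom P Q)) = _
  have h₃ := rootHom_ne_zero P (X.obj.X (a + 1))
  have h₄ := rootHom_ne_zero (X.obj.X (a + 1)) P
  field_simp

/-- Multiplying by the disk on the right or on the left gives multiples of the same direct sum, and
invariance removes the disk on the left. The scalar is the ratio of the two multiples. -/
lemma actInv_disk_apply (a : ZMod 2) (P : 𝒜) [Projective P] (X : C₂P 𝒜) (f : invariants 𝒜) :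
    (actInv (diskP a P) f).1 (isoClass X) = diskScalar a P X * f.1 (isoClass X) := by
  rw [actInv_apply, hallSum_disk_right]
  conv_rhs => rw [← mem_invariants_iff.1 f.2 a P X]
  rw [diskScalar]
  have h₁ := rootHom_ne_zero P (X.obj.X a)
  have h₂ := rootHom_ne_zero P (X.obj.X (a + 1))
  have h₄ := rootHom_ne_zero (X.obj.X (a + 1)) P
  field_simp

lemma isUnit_actInv_disk (a : ZMod 2) (P : 𝒜) [Projective P] : IsUnit (actInv (diskP a P)) := by
  rw [Module.End.isUnit_iff]
  constructor
  · rw [← LinearMap.ker_eq_bot, LinearMap.ker_eq_bot']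
    intro f hf
    ext c
    induction c using Quotient.inductionOn with | _ X
    have := actInv_disk_apply a P X f
    rw [hf] at this
    exact (mul_eq_zero.1 this.symm).resolve_left (diskScalar_ne_zero a P X)
  · intro f
    -- The preimage of `f` is its pointwise quotient by the scalar.
    let g : IsoClass (C₂P 𝒜) → ℂ := fun c => (diskScalar a P c.out)⁻¹ * f.1 c
    have hg (X : C₂P 𝒜) : g (isoClass X) = (diskScalar a P X)⁻¹ * f.1 (isoClass X) := by
      rw [← diskScalar_congr a P (outIso X)]
    refine ⟨⟨g, ?_⟩, ?_⟩
    · rw [mem_invariants_iff]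
      intro b Q _ X
      rw [hg, hg, diskScalar_sumP_disk, ← mem_invariants_iff.1 f.2 b Q X]
      ring
    · ext c
      induction c using Quotient.inductionOn with | _ X
      refine (actInv_disk_apply a P X _).trans ?_
      refine (congrArg _ (hg X)).trans ?_
      rw [← mul_assoc, mul_inv_cancel₀ (diskScalar_ne_zero a P X), one_mul]

/-- Extensions between disks split, so the product of the two invertible operators is a nonzero
multiple of the operator of the sum. -/
lemma isUnit_actInv_sumP_disk (a b : ZMod 2) (P Q : 𝒜) [Projective P] [Projective Q] :
    IsUnit (actInv (sumP (diskP a P) (diskP b Q))) := by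
  have h := (isUnit_actInv_disk a P).mul (isUnit_actInv_disk b Q)
  have := isIso_diskComplex_d a P
  have hb := bijective_cocycle_of_isIso a (diskComplex a P) (diskComplex b Q)
  rw [actInv_mul_actInv, Finset.sum_congr rfl
    (g := fun _ => actInv (sumP (diskP a P) (diskP b Q))), Finset.sum_const] at h
  · have h₀ : (rootNat (Nat.card (DegHom (diskP a P).obj (diskP b Q).obj)))⁻¹ *
        (Finset.univ (α := Cocycle (diskP a P).obj (diskP b Q).obj)).card ≠ 0 := by
      have : Nonempty (Cocycle (diskP a P).obj (diskP b Q).obj) := ⟨Cocycle.zero _ _⟩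
      refine mul_ne_zero (inv_ne_zero (rootNat_card_ne_zero _)) (Nat.cast_ne_zero.2 ?_)
      exact Finset.card_ne_zero.2 Finset.univ_nonempty
    rw [← Nat.cast_smul_eq_nsmul ℂ, smul_smul] at h
    exact (isUnit_smul_iff (Units.mk0 _ h₀) _).1 h
  · intro z _
    obtain ⟨x, rfl⟩ := hb.2 z
    exact actInv_congr ((Cocycle.zero _ _).twistAddδ _)

/-- Adding a zero complex does not change a complex. -/
def twistOfIsZero {M N : C₂ 𝒜} (hN : IsZero N) (z : Cocycle M N) : z.twist ≅ M :=
  have hN' (i : ZMod 2) : IsZero (N.X i) := (HomologicalComplex.eval 𝒜 _ i).map_isZero hN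
  HomologicalComplex.Hom.isoOfComponents
    (fun i =>
      { hom := z.snd i
        inv := z.inr i
        hom_inv_id := by
          apply z.hom_ext
          · exact (hN' i).eq_of_tgt _ _
          · simp
        inv_hom_id := by simp })
    (fun i j _ => by simp)

lemma actInv_of_isZero (Z : C₂P 𝒜) (hZ : IsZero Z.obj) : actInv Z = 1 := by
  ext f c
  induction c using Quotient.inductionOn with | _ X
  have hZ' (i : ZMod 2) : IsZero (Z.obj.X i) := (HomologicalComplex.eval 𝒜 _ i).map_isZero hZ
  have h₁ : Subsingleton (Cocycle X.obj Z.obj) :=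
    ⟨fun z w => by ext i j; exact (hZ' j).eq_of_tgt _ _⟩
  have h₂ : Subsingleton (DegHom X.obj Z.obj) :=
    ⟨fun z w => by ext i; exact (hZ' i).eq_of_tgt _ _⟩
  refine (actInv_apply Z X f).trans ?_
  rw [hallSum, Nat.card_unique, rootNat_one, inv_one, one_mul,
    Fintype.sum_subsingleton _ (Cocycle.zero X.obj Z.obj)]
  exact congrArg f.1 (isoClass_eq_iff.2 ⟨twistOfIsZero hZ _⟩)

end Disks

/-! ### Acyclic complexes of projectives -/

section Acyclic

variable {𝒜 : Type u} [Category.{v} 𝒜] [Abelian 𝒜]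

/-- The morphism from a disk complex given by a morphism in its first degree. -/
def fromDisk {a : ZMod 2} {P : 𝒜} {K : C₂ 𝒜} (g : P ⟶ K.X a) : diskComplex a P ⟶ K where
  f := Function.update (fun j => g ≫ K.d a j) a g
  comm' i j hij := by
    obtain rfl : i + 1 = j := hij
    rcases zmod_two_cases a i with rfl | rfl
    · simp [diskComplex]
    · simp [diskComplex]

lemma fromDisk_f_self {a : ZMod 2} {P : 𝒜} {K : C₂ 𝒜} (g : P ⟶ K.X a) :
    (fromDisk g).f a = g := by
  exact Function.update_self (β := fun j => P ⟶ K.X j) a g fun j => g ≫ K.d a j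

lemma fromDisk_f_of_ne {a : ZMod 2} {P : 𝒜} {K : C₂ 𝒜} (g : P ⟶ K.X a) {j : ZMod 2} (h : j ≠ a) :
    (fromDisk g).f j = g ≫ K.d a j := by
  exact Function.update_of_ne (β := fun j => P ⟶ K.X j) h g fun j => g ≫ K.d a j

lemma Cocycle.isIso_desc {M N : C₂ 𝒜} (z : Cocycle M N) {i : ZMod 2} {T : 𝒜} {u : N.X i ⟶ T}
    {v : M.X i ⟶ T} (u' : T ⟶ N.X i) (v' : T ⟶ M.X i) (huu : u ≫ u' = 𝟙 _) (hvv : v ≫ v' = 𝟙 _)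
    (huv : u ≫ v' = 0) (hvu : v ≫ u' = 0) (h : u' ≫ u + v' ≫ v = 𝟙 _) :
    IsIso (z.fst i ≫ u + z.snd i ≫ v) :=
  ⟨⟨u' ≫ z.inl i + v' ≫ z.inr i,
    by apply z.hom_ext <;> apply z.hom_ext' <;> simp [huu, hvv, huv, hvu], by simpa using h⟩⟩

/-- The morphism from the quotient by the cycles to the cycles. -/
def toKernel (K : C₂ 𝒜) (i : ZMod 2) : K.X i ⟶ kernel (K.d (i + 1) (i + 1 + 1)) :=
  kernel.lift _ (K.d i (i + 1)) (K.d_comp_d _ _ _)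

lemma kernel_ι_toKernel (K : C₂ 𝒜) (i : ZMod 2) :
    kernel.ι (K.d i (i + 1)) ≫ toKernel K i = 0 := by
  rw [← cancel_mono (kernel.ι _)]
  simp [toKernel]

lemma shortExact_toKernel {K : C₂ 𝒜} (hK : K.Acyclic) (i : ZMod 2) :
    (ShortComplex.mk _ _ (kernel_ι_toKernel K i)).ShortExact := by
  have h : (K.sc' i (i + 1) (i + 1 + 1)).Exact :=
    (K.exactAt_iff' _ _ _ (ComplexShape.prev_eq' _ rfl) (ComplexShape.next_eq' _ rfl)).1 (hK _)
  have : Epi (toKernel K i) := (ShortComplex.exact_iff_epi_kernel_lift _).1 h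
  refine ShortComplex.ShortExact.mk' ?_ inferInstance this
  refine ShortComplex.exact_of_f_is_kernel _ ?_
  refine KernelFork.IsLimit.ofι' _ _ fun {A} k hk => ⟨kernel.lift _ k ?_, kernel.lift_ι _ _ _⟩
  have := congrArg (fun t => t ≫ kernel.ι _) hk
  simpa [toKernel] using this

/-- In 0 → Z_i → K_i → Z_{i+1} → 0 the middle term is projective, so a positive bound on the
projective dimension of both cycle objects improves by one; periodicity allows repeating this down
to zero. -/
lemma projective_kernel (hgl : HasFiniteGlobalDimension 𝒜) {K : C₂ 𝒜} (hK : K.Acyclic)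
    (hP : ∀ i, Projective (K.X i)) (i : ZMod 2) : Projective (kernel (K.d i (i + 1))) := by
  obtain ⟨d, hd⟩ := hgl
  have : ∀ n : ℕ, (∀ i, HasProjectiveDimensionLT (kernel (K.d i (i + 1))) (n + 1)) →
      ∀ i, Projective (kernel (K.d i (i + 1))) := by
    intro n
    induction n with
    | zero => exact fun h i => projective_iff_hasProjectiveDimensionLT_one.2 (h i)
    | succ n ih =>
      refine fun h => ih fun i => ?_
      have := hP i
      exact (shortExact_toKernel hK i).hasProjectiveDimensionLT_X₁ (n + 1)
        (inferInstanceAs (HasProjectiveDimensionLT (K.X i) (n + 1))) (h (i + 1))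
  exact this d (fun i => hd _) i

/-- The cycles are projective, so K_i is the sum of Z_i and a copy of Z_{i+1} which the differential
maps isomorphically onto the cycles Z_{i+1}. The two disks are those on Z_0 and Z_1. -/
theorem exists_iso_sum_disk (hgl : HasFiniteGlobalDimension 𝒜) {K : C₂ 𝒜} (hK : K.Acyclic)
    (hP : ∀ i, Projective (K.X i)) : ∃ (P Q : 𝒜), Projective P ∧ Projective Q ∧
      Nonempty ((Cocycle.zero (diskComplex 1 P) (diskComplex 0 Q)).twist ≅ K) := by
  have hproj := projective_kernel hgl hK hP
  have hs (i : ZMod 2) : ∃ s : kernel (K.d (i + 1) (i + 1 + 1)) ⟶ K.X i,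
      s ≫ toKernel K i = 𝟙 _ := by
    have := hproj (i + 1)
    have := (shortExact_toKernel hK i).epi_g
    exact Projective.factors (𝟙 _) (toKernel K i)
  choose s hs using hs
  have hd (i : ZMod 2) : s i ≫ K.d i (i + 1) = kernel.ι _ := by
    have := congrArg (fun t => t ≫ kernel.ι _) (hs i)
    simpa [toKernel] using this
  -- The splitting of K_i, with the inclusion of cycles written as `s j ≫ K.d j i`. Keeping `i`
  -- separate from `j + 1` lets both degrees be treated without transport.
  have hr (i j : ZMod 2) (h : j + 1 = i) : ∃ r : K.X i ⟶ kernel (K.d (j + 1) (j + 1 + 1)),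
      (s j ≫ K.d j i) ≫ r = 𝟙 _ ∧ (s j ≫ K.d j i) ≫ toKernel K i = 0 ∧ s i ≫ r = 0 ∧
        r ≫ s j ≫ K.d j i + toKernel K i ≫ s i = 𝟙 _ := by
    subst h
    have h := shortExact_toKernel hK (j + 1)
    let σ := ShortComplex.Splitting.ofExactOfSection _ h.exact (s (j + 1)) (hs (j + 1)) h.mono_f
    rw [hd]
    exact ⟨σ.r, σ.f_r, kernel_ι_toKernel K _, σ.s_r, σ.id⟩
  let φ : (Cocycle.zero (diskComplex 1 (kernel (K.d (1 + 1) (1 + 1 + 1))))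
      (diskComplex 0 (kernel (K.d (0 + 1) (0 + 1 + 1))))).twist ⟶ K :=
    { f i := Cocycle.fst _ i ≫ (fromDisk (s 0)).f i + Cocycle.snd _ i ≫ (fromDisk (s 1)).f i
      comm' i j _ := by
        apply Cocycle.hom_ext'
        · simp
        · simp }
  refine ⟨_, _, hproj (1 + 1), hproj (0 + 1), ⟨?_⟩⟩
  have (i : ZMod 2) : IsIso (φ.f i) := by
    rcases (show i = 0 ∨ i = 1 from zmod_two_cases 0 i) with rfl | rfl
    · obtain ⟨r, h₁, h₂, h₃, h₄⟩ := hr 0 1 rfl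
      have e : φ.f 0 = Cocycle.fst _ 0 ≫ s 0 + Cocycle.snd _ 0 ≫ s 1 ≫ K.d 1 0 := by
        change _ ≫ (fromDisk (s 0)).f 0 + _ ≫ (fromDisk (s 1)).f 0 = _
        rw [fromDisk_f_self, fromDisk_f_of_ne _ (by decide)]
        rfl
      rw [e]
      exact Cocycle.isIso_desc _ (toKernel K 0) r (hs 0) h₁ h₃ h₂ (by rw [add_comm]; exact h₄)
    · obtain ⟨r, h₁, h₂, h₃, h₄⟩ := hr 1 0 rfl
      have e : φ.f 1 = Cocycle.fst _ 1 ≫ s 0 ≫ K.d 0 1 + Cocycle.snd _ 1 ≫ s 1 := by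
        change _ ≫ (fromDisk (s 0)).f 1 + _ ≫ (fromDisk (s 1)).f 1 = _
        rw [fromDisk_f_self, fromDisk_f_of_ne _ (by decide)]
        rfl
      rw [e]
      exact Cocycle.isIso_desc _ r (toKernel K 1) h₁ (hs 1) h₂ h₃ h₄
  have := HomologicalComplex.Hom.isIso_of_components φ
  exact asIso φ

end Acyclic

/-! ### Invariant functionals attached to complexes -/

section TestFunctions

variable {𝒜 : Type u} [Category.{v} 𝒜] [Abelian 𝒜]

/-- The homology of a complex does not change when an acyclic complex is added. -/
def homologySumIso {M : C₂ 𝒜} (hM : M.Acyclic) (N : C₂ 𝒜) (i : ZMod 2) :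
    (Cocycle.zero M N).twist.homology i ≅ N.homology i :=
  let z := Cocycle.zero M N
  let π : z.twist ⟶ N := { f := z.fst, comm' := fun i j _ => by simp [z] }
  let σ : M ⟶ z.twist := { f := z.inr, comm' := fun i j _ => by simp [z] }
  { hom := HomologicalComplex.homologyMap π i
    inv := HomologicalComplex.homologyMap z.inclusion i
    hom_inv_id := by
      have h : π ≫ z.inclusion + z.projection ≫ σ = 𝟙 _ := by
        ext i
        exact z.total i
      have h₀ : HomologicalComplex.homologyMap z.projection i = 0 :=
        (hM i).isZero_homology.eq_of_tgt _ _
      have := congrArg (fun t => HomologicalComplex.homologyMap t i) h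
      simpa only [HomologicalComplex.homologyMap_add, HomologicalComplex.homologyMap_comp, h₀,
        zero_comp, add_zero, HomologicalComplex.homologyMap_id] using this
    inv_hom_id := by
      have h : z.inclusion ≫ π = 𝟙 _ := by
        ext i
        exact z.inl_fst i
      rw [← HomologicalComplex.homologyMap_comp, h, HomologicalComplex.homologyMap_id] }

/-- The morphisms to `Y` from degree `i` which factor through the differential. -/
abbrev FactorThruD (X : C₂ 𝒜) (i : ZMod 2) (Y : 𝒜) : Type v :=
  Set.range fun g : X.X (i + 1) ⟶ Y => X.d i (i + 1) ≫ g

/-- The square root of the number of morphisms which factor through the differential. -/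
def rootRange (X : C₂ 𝒜) (i : ZMod 2) (Y : 𝒜) : ℂ := rootNat (Nat.card (FactorThruD X i Y))

lemma rootRange_ne_zero [∀ X Y : 𝒜, Finite (X ⟶ Y)] (X : C₂ 𝒜) (i : ZMod 2) (Y : 𝒜) :
    rootRange X i Y ≠ 0 := rootNat_card_ne_zero _

lemma rootRange_congr {X X' : C₂ 𝒜} (e : X ≅ X') (i : ZMod 2) (Y : 𝒜) :
    rootRange X i Y = rootRange X' i Y := by
  have h₁ (j : ZMod 2) {T : 𝒜} (g : X.X j ⟶ T) : e.hom.f j ≫ e.inv.f j ≫ g = g := by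
    rw [← HomologicalComplex.comp_f_assoc, e.hom_inv_id, HomologicalComplex.id_f, Category.id_comp]
  have h₂ (j : ZMod 2) {T : 𝒜} (g : X'.X j ⟶ T) : e.inv.f j ≫ e.hom.f j ≫ g = g := by
    rw [← HomologicalComplex.comp_f_assoc, e.inv_hom_id, HomologicalComplex.id_f, Category.id_comp]
  rw [rootRange, rootRange]
  congr 1
  exact Nat.card_congr
    { toFun r := ⟨e.inv.f i ≫ r.1, by
        obtain ⟨_, g, rfl⟩ := r
        exact ⟨e.inv.f (i + 1) ≫ g, by simp⟩⟩
      invFun r := ⟨e.hom.f i ≫ r.1, by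
        obtain ⟨_, g, rfl⟩ := r
        exact ⟨e.hom.f (i + 1) ≫ g, by simp⟩⟩
      left_inv r := Subtype.ext (h₁ _ _)
      right_inv r := Subtype.ext (h₂ _ _) }

lemma rootRange_sum (M N : C₂ 𝒜) (i : ZMod 2) (Y : 𝒜) :
    rootRange (Cocycle.zero M N).twist i Y = rootRange N i Y * rootRange M i Y := by
  rw [rootRange, rootRange, rootRange, ← rootNat_mul, ← Nat.card_prod]
  congr 1
  let z := Cocycle.zero M N
  exact Nat.card_congr
    { toFun r := (⟨z.inl i ≫ r.1, by
          obtain ⟨_, g, rfl⟩ := r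
          exact ⟨z.inl (i + 1) ≫ g, by simp [z]⟩⟩,
        ⟨z.inr i ≫ r.1, by
          obtain ⟨_, g, rfl⟩ := r
          exact ⟨z.inr (i + 1) ≫ g, by simp [z]⟩⟩)
      invFun r := ⟨z.fst i ≫ r.1.1 + z.snd i ≫ r.2.1, by
        obtain ⟨⟨_, g, rfl⟩, ⟨_, g', rfl⟩⟩ := r
        exact ⟨z.fst (i + 1) ≫ g + z.snd (i + 1) ≫ g', by simp [z]⟩⟩
      left_inv r := by
        apply Subtype.ext
        apply z.hom_ext' <;> simp
      right_inv r := by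
        ext <;> simp }

lemma rootRange_disk_self (a : ZMod 2) (P Y : 𝒜) :
    rootRange (diskComplex a P) a Y = rootHom P Y := by
  have := isIso_diskComplex_d a P
  rw [rootRange, rootHom]
  congr 1
  refine Nat.card_congr ((Equiv.setCongr (t := Set.univ) ?_).trans (Equiv.Set.univ _))
  refine Set.range_eq_univ.2 fun g => ⟨inv ((diskComplex a P).d a (a + 1)) ≫ g, ?_⟩
  exact IsIso.hom_inv_id_assoc _ _

lemma rootRange_disk_add_one (a : ZMod 2) (P Y : 𝒜) :
    rootRange (diskComplex a P) (a + 1) Y = 1 := by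
  have h : (diskComplex a P).d (a + 1) (a + 1 + 1) = 0 := by
    have := isIso_diskComplex_d a P
    rw [← cancel_epi ((diskComplex a P).d a (a + 1))]
    simp
  rw [rootRange]
  have : Subsingleton (FactorThruD (diskComplex a P) (a + 1) Y) :=
    ⟨by rintro ⟨_, g, rfl⟩ ⟨_, g', rfl⟩; simp [h]⟩
  have : Nonempty (FactorThruD (diskComplex a P) (a + 1) Y) := ⟨⟨_, 0, rfl⟩⟩
  rw [Nat.card_unique, rootNat_one]

/-- The condition that `X` and `C` have isomorphic homology in degree zero and the same class. -/
def SameClass (C X : C₂ 𝒜) : Prop :=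
  Nonempty (X.homology 0 ≅ C.homology 0) ∧ ∀ (P : 𝒜) (i : ZMod 2),
    rootHom P (X.X i) * rootHom P (C.X (i + 1)) = rootHom P (X.X (i + 1)) * rootHom P (C.X i)

lemma sameClass_refl (C : C₂ 𝒜) : SameClass C C := ⟨⟨Iso.refl _⟩, fun _ _ => mul_comm _ _⟩

lemma sameClass_congr (C : C₂ 𝒜) {X X' : C₂ 𝒜} (e : X ≅ X') : SameClass C X ↔ SameClass C X' := by
  have h (P : 𝒜) (i : ZMod 2) : rootHom P (X.X i) = rootHom P (X'.X i) :=
    rootHom_congr (Iso.refl P) ((HomologicalComplex.eval 𝒜 _ i).mapIso e)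
  have e₀ : X.homology 0 ≅ X'.homology 0 :=
    (HomologicalComplex.homologyFunctor 𝒜 _ 0).mapIso e
  simp only [SameClass, h]
  exact and_congr ⟨fun ⟨t⟩ => ⟨e₀.symm ≪≫ t⟩, fun ⟨t⟩ => ⟨e₀ ≪≫ t⟩⟩ Iff.rfl

/-- The scaling factor of the functional attached to `C`. -/
def testWeight (C X : C₂ 𝒜) : ℂ :=
  rootRange X 0 (C.X 0) / rootRange X 0 (C.X 1) * (rootRange X 1 (C.X 1) / rootRange X 1 (C.X 0))

lemma testWeight_eq (C X : C₂ 𝒜) (a : ZMod 2) :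
    testWeight C X = rootRange X a (C.X a) / rootRange X a (C.X (a + 1)) *
      (rootRange X (a + 1) (C.X (a + 1)) / rootRange X (a + 1) (C.X a)) := by
  rcases (show a = 0 ∨ a = 1 from zmod_two_cases 0 a) with rfl | rfl
  · rfl
  · exact mul_comm _ _

lemma testWeight_congr (C : C₂ 𝒜) {X X' : C₂ 𝒜} (e : X ≅ X') :
    testWeight C X = testWeight C X' := by
  simp only [testWeight, rootRange_congr e]

/-- In the disk every morphism out of degree `a` factors through the differential, and only zero
does so out of degree `a + 1`. The weight is built from these counts to change by exactly this
factor. -/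
lemma testWeight_sum_disk (C X : C₂ 𝒜) (a : ZMod 2) (P : 𝒜) :
    testWeight C (Cocycle.zero (diskComplex a P) X).twist =
      testWeight C X * (rootHom P (C.X a) / rootHom P (C.X (a + 1))) := by
  rw [testWeight_eq C _ a, testWeight_eq C _ a]
  simp only [rootRange_sum, rootRange_disk_self, rootRange_disk_add_one]
  ring

open Classical in
/-- The functional attached to `C`. -/
def testFun (C : C₂ 𝒜) (c : IsoClass (C₂P 𝒜)) : ℂ :=
  if SameClass C c.out.obj then testWeight C c.out.obj else 0

open Classical in
lemma testFun_apply (C : C₂ 𝒜) (X : C₂P 𝒜) :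
    testFun C (isoClass X) = if SameClass C X.obj then testWeight C X.obj else 0 := by
  rw [testFun, testWeight_congr C (outIso X), if_congr (sameClass_congr C (outIso X)) rfl rfl]

lemma nonempty_iso_of_testFun_ne_zero {C : C₂ 𝒜} {X : C₂P 𝒜} (h : testFun C (isoClass X) ≠ 0) :
    Nonempty (X.obj.homology 0 ≅ C.homology 0) := by
  rw [testFun_apply] at h
  by_contra h'
  exact h (if_neg fun hs => h' hs.1)

variable [∀ X Y : 𝒜, Finite (X ⟶ Y)]

lemma testWeight_ne_zero (C X : C₂ 𝒜) : testWeight C X ≠ 0 :=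
  mul_ne_zero (div_ne_zero (rootRange_ne_zero _ _ _) (rootRange_ne_zero _ _ _))
    (div_ne_zero (rootRange_ne_zero _ _ _) (rootRange_ne_zero _ _ _))

/-- The disk is acyclic, and its equal contributions in the two degrees cancel. -/
lemma sameClass_sum_disk (C X : C₂ 𝒜) (a : ZMod 2) (P : 𝒜) :
    SameClass C (Cocycle.zero (diskComplex a P) X).twist ↔ SameClass C X := by
  have e := homologySumIso (diskComplex_acyclic a P) X 0
  refine and_congr ⟨fun ⟨t⟩ => ⟨e.symm ≪≫ t⟩, fun ⟨t⟩ => ⟨e ≪≫ t⟩⟩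
    (forall_congr' fun Q => forall_congr' fun i => ?_)
  rw [rootHom_twist_right, rootHom_twist_right]
  change rootHom Q (X.X i) * rootHom Q P * _ = rootHom Q (X.X (i + 1)) * rootHom Q P * _ ↔ _
  rw [mul_right_comm, mul_right_comm (rootHom Q (X.X (i + 1)))]
  exact mul_left_inj' (rootHom_ne_zero Q P)

lemma testFun_self_ne_zero (C : C₂P 𝒜) : testFun C.obj (isoClass C) ≠ 0 := by
  rw [testFun_apply, if_pos (sameClass_refl _)]
  exact testWeight_ne_zero _ _

-- On the support of the functional, the class condition replaces the ratio |Hom(P, X_{a+1})| /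
-- |Hom(P, X_a)| by the same ratio for `C`. The factor in the invariance equation then depends on
-- `P` and `C` only, and the weight compensates for it.
open Classical in
lemma testFun_mem_invariants (C : C₂ 𝒜) : testFun C ∈ invariants 𝒜 := by
  rw [mem_invariants_iff]
  intro a P _ X
  rw [testFun_apply, testFun_apply]
  change _ * (if SameClass C (Cocycle.zero (diskComplex a P) X.obj).twist
    then testWeight C (Cocycle.zero (diskComplex a P) X.obj).twist else 0) = _
  by_cases h : SameClass C X.obj
  · rw [if_pos h, if_pos ((sameClass_sum_disk C X.obj a P).2 h), testWeight_sum_disk]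
    have h₁ := h.2 P a
    have h₂ := rootHom_ne_zero P (X.obj.X a)
    have h₃ := rootHom_ne_zero P (C.X (a + 1))
    field_simp
    linear_combination (-testWeight C X.obj) * h₁
  · rw [if_neg h, if_neg (mt (sameClass_sum_disk C X.obj a P).1 h), mul_zero]

end TestFunctions

/-! ### The representation of Bridgeland's Hall algebra on the invariant functionals -/

section Representation

variable {𝒜 : Type u} [Category.{v} 𝒜] [Abelian 𝒜] [∀ X Y : 𝒜, Finite (X ⟶ Y)]

lemma isUnit_actInv (hgl : HasFiniteGlobalDimension 𝒜) (M : C₂P 𝒜) (hM : M.obj.Acyclic) :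
    IsUnit (actInv M) := by
  obtain ⟨P, Q, hP, hQ, ⟨e⟩⟩ := exists_iso_sum_disk hgl hM M.property
  rw [← actInv_congr (N := sumP (diskP 1 P) (diskP 0 Q)) e]
  exact isUnit_actInv_sumP_disk 1 0 P Q

variable (k : Type*) [Field k] [Linear k 𝒜]

/-- The action of the Hall algebra on the invariant functionals. -/
def hallRep : HallC₂P k 𝒜 →ₗ[ℂ] Module.End ℂ (invariants 𝒜) :=
  (Finsupp.linearCombination ℂ fun c : IsoClass (C₂P 𝒜) => actInv c.out :
    (IsoClass (C₂P 𝒜) →₀ ℂ) →ₗ[ℂ] Module.End ℂ (invariants 𝒜))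

lemma hallRep_single (c : IsoClass (C₂P 𝒜)) (r : ℂ) :
    hallRep k (Finsupp.single c r : IsoClass (C₂P 𝒜) →₀ ℂ) = r • actInv c.out :=
  Finsupp.linearCombination_single _ _ _

lemma hallRep_twistedHallProduct [Finite k] (a b : IsoClass (C₂P 𝒜)) :
    hallRep k (twistedHallProduct (fun c : IsoClass (C₂P 𝒜) => c.out.obj)
      (fun M N => vParam k ^ (eulerForm k (M.X 0) (N.X 0) + eulerForm k (M.X 1) (N.X 1))) a b) =
    actInv a.out * actInv b.out := by
  rw [twistedHallProduct_eq, actInv_mul_actInv]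
  refine (map_smul (hallRep k) _ _).trans ?_
  congr 1
  refine (map_sum (hallRep k) _ _).trans (Finset.sum_congr rfl fun z _ => ?_)
  rw [hallRep_single, one_smul]
  exact actInv_congr (outIso _)

lemma hallRep_mul [Finite k] (x y : HallC₂P k 𝒜) :
    hallRep k (x * y) = hallRep k x * hallRep k y := by
  have h₁ : hallRep k (x * y) = Finsupp.sum x fun a r => Finsupp.sum y fun b s =>
      (r * s) • (actInv a.out * actInv b.out) := by
    refine (map_finsuppSum (hallRep k) x _).trans (Finsupp.sum_congr fun a _ => ?_)
    refine (map_finsuppSum (hallRep k) y _).trans (Finsupp.sum_congr fun b _ => ?_)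
    refine (map_smul (hallRep k) _ _).trans ?_
    rw [hallRep_twistedHallProduct]
  have h₂ (x : HallC₂P k 𝒜) : hallRep k x = Finsupp.sum x fun a r => r • actInv a.out :=
    Finsupp.linearCombination_apply _ _
  have h₃ (x y : IsoClass (C₂P 𝒜) →₀ ℂ) :
      (x.sum fun a r => y.sum fun b s => (r * s) • (actInv a.out * actInv b.out)) =
        (x.sum fun a r => r • actInv a.out) * y.sum fun b s => s • actInv b.out := by
    rw [Finsupp.sum_mul]
    refine Finsupp.sum_congr fun a _ => ?_
    rw [Finsupp.mul_sum]
    refine Finsupp.sum_congr fun b _ => ?_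
    rw [smul_mul_smul_comm]
  exact (h₁.trans (h₃ x y)).trans (congrArg₂ (· * ·) (h₂ x).symm (h₂ y).symm)

/-- The action of the generators of the localization on the invariant functionals. -/
def genRep : LocGen 𝒜 → Module.End ℂ (invariants 𝒜)
  | .cls c => actInv c.out
  -- `Ring.inverse` is zero on non-units; `isUnit_actInv` excludes that case.
  | .inv M _ => Ring.inverse (actInv M)

lemma lift_toFree (x : HallC₂P k 𝒜) :
    FreeAlgebra.lift ℂ (genRep (𝒜 := 𝒜)) (toFree k 𝒜 x) = hallRep k x := by
  refine LinearMap.congr_fun (f := (FreeAlgebra.lift ℂ (genRep (𝒜 := 𝒜))).toLinearMap ∘ₗ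
    toFree k 𝒜) ((HallC₂P.basis k 𝒜).ext fun c => ?_) x
  have : hallRep k (HallC₂P.basis k 𝒜 c) = actInv c.out := by
    have := hallRep_single k c 1
    rw [one_smul] at this
    rw [← this]
    exact congrArg (hallRep k)
      (congrFun (Finsupp.coe_basisSingleOne (R := ℂ) (ι := IsoClass (C₂P 𝒜))) c)
  rw [this, LinearMap.comp_apply, toFree, Module.Basis.constr_basis]
  exact FreeAlgebra.lift_ι_apply _ _

lemma hallRep_basis (M : C₂P 𝒜) :
    hallRep k (HallC₂P.basis k 𝒜 (isoClass M)) = actInv M := by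
  rw [← lift_toFree, toFree, Module.Basis.constr_basis, FreeAlgebra.lift_ι_apply]
  exact actInv_congr (outIso M)

variable [Finite k]

/-- The representation of `DH₂(𝒜)` on the invariant functionals. -/
def rep (hgl : HasFiniteGlobalDimension 𝒜) : DH₂ k 𝒜 →ₐ[ℂ] Module.End ℂ (invariants 𝒜) :=
  RingQuot.liftAlgHom ℂ ⟨FreeAlgebra.lift ℂ (genRep (𝒜 := 𝒜)), fun x y h => by
    cases h with
    | mul x y => rw [map_mul, lift_toFree, lift_toFree, lift_toFree, hallRep_mul]
    | one Z hZ => rw [lift_toFree, hallRep_basis, map_one, actInv_of_isZero Z hZ]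
    | mul_inv M hM =>
      rw [map_mul, lift_toFree, hallRep_basis, map_one, FreeAlgebra.lift_ι_apply]
      exact Ring.mul_inverse_cancel _ (isUnit_actInv hgl M hM)
    | inv_mul M hM =>
      rw [map_mul, lift_toFree, hallRep_basis, map_one, FreeAlgebra.lift_ι_apply]
      exact Ring.inverse_mul_cancel _ (isUnit_actInv hgl M hM)⟩

lemma rep_cls (hgl : HasFiniteGlobalDimension 𝒜) (M : C₂P 𝒜) :
    rep k hgl (DH₂.cls k M) = actInv M := by
  rw [← hallRep_basis k M, ← lift_toFree]
  exact RingQuot.liftAlgHom_mkAlgHom_apply ℂ _ _ _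

open ZeroObject in
variable (𝒜) in
/-- The zero complex as an object of `C₂(𝒫)`. -/
def zeroP : C₂P 𝒜 := ⟨0, fun i =>
  ((HomologicalComplex.eval 𝒜 _ i).map_isZero (isZero_zero (C₂ 𝒜))).projective⟩

/-- The zero complex is the unit of the product, so evaluating there recovers f([M]). -/
lemma actInv_apply_zeroP (M : C₂P 𝒜) (f : invariants 𝒜) :
    (actInv M f).1 (isoClass (zeroP 𝒜)) = f.1 (isoClass M) := by
  have hZ (i : ZMod 2) : IsZero ((zeroP 𝒜).obj.X i) :=
    (HomologicalComplex.eval 𝒜 _ i).map_isZero (isZero_zero (C₂ 𝒜))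
  have h₁ : Subsingleton (Cocycle (zeroP 𝒜).obj M.obj) :=
    ⟨fun z w => by ext i j; exact (hZ i).eq_of_src _ _⟩
  have h₂ : Subsingleton (DegHom (zeroP 𝒜).obj M.obj) :=
    ⟨fun z w => by ext i; exact (hZ i).eq_of_src _ _⟩
  rw [actInv_apply, hallSum, Nat.card_unique, rootNat_one, inv_one, one_mul,
    Fintype.sum_subsingleton _ (Cocycle.zero (zeroP 𝒜).obj M.obj)]
  exact congrArg f.1 (isoClass_eq_iff.2
    ⟨sumComm _ _ ≪≫ twistOfIsZero (isZero_zero (C₂ 𝒜)) (Cocycle.zero M.obj _)⟩)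

/-- The units of `DH₂(𝒜)` which act as a scalar after evaluation at the zero complex. -/
def diagonalUnits (hgl : HasFiniteGlobalDimension 𝒜) : Subgroup (DH₂ k 𝒜)ˣ where
  carrier := {x | ∃ r : ℂ, r ≠ 0 ∧ ∀ f : invariants 𝒜,
    (rep k hgl (x : DH₂ k 𝒜) f).1 (isoClass (zeroP 𝒜)) = r * f.1 (isoClass (zeroP 𝒜))}
  one_mem' := ⟨1, one_ne_zero, fun f => by rw [Units.val_one, map_one, one_mul]; rfl⟩
  mul_mem' := by
    rintro x y ⟨r, hr, h⟩ ⟨s, hs, h'⟩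
    refine ⟨r * s, mul_ne_zero hr hs, fun f => ?_⟩
    rw [Units.val_mul, map_mul, Module.End.mul_apply, h, h', mul_assoc]
  inv_mem' := by
    rintro x ⟨r, hr, h⟩
    refine ⟨r⁻¹, inv_ne_zero hr, fun f => ?_⟩
    -- The scalar identity for `x` is applied to the translate of `f` by the inverse.
    have := h (rep k hgl (x⁻¹ : (DH₂ k 𝒜)ˣ) f)
    rw [← Module.End.mul_apply, ← map_mul, Units.mul_inv, map_one, Module.End.one_apply] at this
    rw [this, inv_mul_cancel_left₀ hr]

lemma unit_disk_mem_diagonalUnits (hgl : HasFiniteGlobalDimension 𝒜) (a : ZMod 2) (P : 𝒜)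
    [Projective P] : DH₂.unit k (diskP a P) (diskComplex_acyclic a P) ∈ diagonalUnits k hgl := by
  refine ⟨diskScalar a P (zeroP 𝒜), diskScalar_ne_zero _ _ _, fun f => ?_⟩
  rw [← actInv_disk_apply, ← rep_cls k hgl]
  rfl

/-- Only membership in this subgroup is needed, so neither the chosen `P`, `Q` nor the default value
1 matters. -/
lemma elemK_mem_diagonalUnits (hgl : HasFiniteGlobalDimension 𝒜) (α : GrothendieckK 𝒜) :
    elemK k α ∈ diagonalUnits k hgl := by
  rw [elemK]
  split_ifs with h
  · have := h.choose_spec.1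
    have := h.choose_spec.2.1
    exact mul_mem (unit_disk_mem_diagonalUnits k hgl 1 _)
      (inv_mem (unit_disk_mem_diagonalUnits k hgl 1 _))
  · exact one_mem _

lemma elemKStar_mem_diagonalUnits (hgl : HasFiniteGlobalDimension 𝒜) (α : GrothendieckK 𝒜) :
    elemKStar k α ∈ diagonalUnits k hgl := by
  rw [elemKStar]
  split_ifs with h
  · have := h.choose_spec.1
    have := h.choose_spec.2.1
    exact mul_mem (unit_disk_mem_diagonalUnits k hgl 0 _)
      (inv_mem (unit_disk_mem_diagonalUnits k hgl 0 _))
  · exact one_mem _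

lemma exists_rep_elemE_apply (hgl : HasFiniteGlobalDimension 𝒜) {M : 𝒜} (P : FiniteResolution M) :
    ∃ r : ℂ, r ≠ 0 ∧ ∀ f : invariants 𝒜,
      (rep k hgl (P.elemE k) f).1 (isoClass (zeroP 𝒜)) =
        r * f.1 (isoClass P.foldedComplex) := by
  obtain ⟨r, hr, h⟩ := mul_mem (elemK_mem_diagonalUnits k hgl (-kClass P.oddPart))
    (elemKStar_mem_diagonalUnits k hgl (-kClass P.evenPart))
  refine ⟨vParam k ^ (eulerForm k P.oddPart M - eulerForm k P.evenPart M) * r,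
    mul_ne_zero (zpow_ne_zero _ (vParam_ne_zero k)) hr, fun f => ?_⟩
  rw [FiniteResolution.elemE, map_smul, map_mul, ← Units.val_mul, LinearMap.smul_apply,
    Module.End.mul_apply, rep_cls, Submodule.coe_smul, Pi.smul_apply, h, actInv_apply_zeroP,
    smul_eq_mul, mul_assoc]

theorem linearIndependent_elemE (hgl : HasFiniteGlobalDimension 𝒜)
    (R : ∀ M : 𝒜, FiniteResolution M)
    (hR : ∀ M, Nonempty ((R M).foldedComplex.obj.homology 0 ≅ M)) :
    LinearIndependent ℂ (fun c : IsoClass 𝒜 => (R c.out).elemE k) := by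
  choose r hr h using fun M => exists_rep_elemE_apply k hgl (R M)
  rw [linearIndependent_iff']
  intro s g hg c hc
  -- This functional isolates the coefficient of `c`: a nonzero value at another folded resolution
  -- would make the resolved objects isomorphic.
  let f : invariants 𝒜 := ⟨_, testFun_mem_invariants (R c.out).foldedComplex.obj⟩
  have hsum := congrArg (fun x => (rep k hgl x f).1 (isoClass (zeroP 𝒜))) hg
  simp only [map_sum, map_smul, LinearMap.sum_apply, LinearMap.smul_apply, map_zero,
    LinearMap.zero_apply, Submodule.coe_sum, Submodule.coe_smul, Finset.sum_apply, Pi.smul_apply,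
    h, smul_eq_mul, Submodule.coe_zero, Pi.zero_apply] at hsum
  rw [Finset.sum_eq_single_of_mem c hc] at hsum
  · exact (mul_eq_zero.1 hsum).resolve_right (mul_ne_zero (hr _) (testFun_self_ne_zero _))
  · intro b _ hb
    suffices f.1 (isoClass (R b.out).foldedComplex) = 0 by rw [this, mul_zero, mul_zero]
    by_contra hf
    obtain ⟨e⟩ := nonempty_iso_of_testFun_ne_zero hf
    obtain ⟨e₁⟩ := hR b.out
    obtain ⟨e₂⟩ := hR c.out
    apply hb
    rw [← Quotient.out_eq b, ← Quotient.out_eq c]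
    exact Quotient.sound ⟨e₁.symm ≪≫ e ≪≫ e₂⟩

end Representation

/-! ### Injectivity of φ from linear independence -/

section Injectivity

variable {𝒜 : Type u} [Category.{v} 𝒜] [Abelian 𝒜] (k : Type*) [Field k] [Linear k 𝒜]

lemma phi_injective {R : ∀ M : 𝒜, FiniteResolution M}
    (h : LinearIndependent ℂ (fun c : IsoClass 𝒜 => (R c.out).elemE k)) :
    Function.Injective (phi k R) := by
  intro x y hxy
  rw [phi, Module.Basis.constr_apply, Module.Basis.constr_apply] at hxy
  exact (RingelHall.basis k 𝒜).repr.injective (h hxy)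

end Injectivity

/-! ### The homology of folded resolutions -/

section Fold

variable {𝒜 : Type u} [Category.{v} 𝒜] [Abelian 𝒜]

/-- A description of the homology of a short complex in terms of generalized elements. -/
lemma nonempty_homology_iso (S : ShortComplex 𝒜) {M : 𝒜} (π : S.X₂ ⟶ M) (hfπ : S.f ≫ π = 0)
    (h₁ : ∀ ⦃T : 𝒜⦄ (y : T ⟶ M), ∃ (T' : 𝒜) (e : T' ⟶ T) (_ : Epi e) (x : T' ⟶ S.X₂),
      x ≫ S.g = 0 ∧ e ≫ y = x ≫ π)
    (h₂ : ∀ ⦃T : 𝒜⦄ (x : T ⟶ S.X₂), x ≫ S.g = 0 → x ≫ π = 0 →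
      ∃ (T' : 𝒜) (e : T' ⟶ T) (_ : Epi e) (z : T' ⟶ S.X₁), e ≫ x = z ≫ S.f) :
    Nonempty (S.homology ≅ M) := by
  have w : kernel.lift S.g S.f S.zero ≫ kernel.ι S.g ≫ π = 0 := by simp [hfπ]
  have hex : (ShortComplex.mk _ _ w).Exact := by
    rw [ShortComplex.exact_iff_exact_up_to_refinements]
    intro T x hx
    obtain ⟨T', e, he, z, hz⟩ := h₂ (x ≫ kernel.ι S.g) (by simp) (by simpa using hx)
    refine ⟨T', e, he, z, ?_⟩
    rw [← cancel_mono (kernel.ι S.g)]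
    simpa using hz
  have hepi : Epi (kernel.ι S.g ≫ π) := by
    rw [epi_iff_surjective_up_to_refinements]
    intro T y
    obtain ⟨T', e, he, x, hx, hxy⟩ := h₁ y
    exact ⟨T', e, he, kernel.lift _ x hx, by simpa using hxy⟩
  let h : S.LeftHomologyData :=
    { K := kernel S.g
      H := M
      i := kernel.ι S.g
      π := kernel.ι S.g ≫ π
      wi := kernel.condition _
      hi := kernelIsKernel _
      wπ := w
      hπ := hex.gIsCokernel }
  exact ⟨h.homologyIso⟩

lemma nonempty_homology_zero_iso (K : C₂ 𝒜) {M : 𝒜} (π : K.X 0 ⟶ M) (hπ : K.d 1 0 ≫ π = 0)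
    (h₁ : ∀ ⦃T : 𝒜⦄ (y : T ⟶ M), ∃ (T' : 𝒜) (e : T' ⟶ T) (_ : Epi e) (x : T' ⟶ K.X 0),
      x ≫ K.d 0 1 = 0 ∧ e ≫ y = x ≫ π)
    (h₂ : ∀ ⦃T : 𝒜⦄ (x : T ⟶ K.X 0), x ≫ K.d 0 1 = 0 → x ≫ π = 0 →
      ∃ (T' : 𝒜) (e : T' ⟶ T) (_ : Epi e) (z : T' ⟶ K.X 1), e ≫ x = z ≫ K.d 1 0) :
    Nonempty (K.homology 0 ≅ M) := by
  have hp : (ComplexShape.up (ZMod 2)).prev 0 = 1 := ComplexShape.prev_eq' _ rfl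
  have hn : (ComplexShape.up (ZMod 2)).next 0 = 1 := ComplexShape.next_eq' _ rfl
  obtain ⟨e⟩ := nonempty_homology_iso (K.sc' 1 0 1) π hπ h₁ h₂
  exact ⟨K.homologyIsoSc' 1 0 1 hp hn ≪≫ e⟩

/-- The element of the folded complex with given components. -/
def foldLift (P : ChainComplex 𝒜 ℕ) (n : ℕ) (j : ZMod 2) {T : 𝒜} (w : ∀ i, T ⟶ P.X i) :
    T ⟶ (fold P n).X j :=
  biproduct.lift fun i : {i : Fin (n + 1) // ((i : ℕ) : ZMod 2) = j} => w (i.1 : ℕ)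

/-- The components of the folded complex. -/
def foldProj (P : ChainComplex 𝒜 ℕ) (n : ℕ) (j : ZMod 2) (i : ℕ) (hi : i ≤ n)
    (hj : (i : ZMod 2) = j) : (fold P n).X j ⟶ P.X i :=
  biproduct.π (fun i : {i : Fin (n + 1) // ((i : ℕ) : ZMod 2) = j} => P.X (i.1 : ℕ))
    ⟨⟨i, Nat.lt_succ_of_le hi⟩, hj⟩

section

variable {P : ChainComplex 𝒜 ℕ} {n : ℕ} {j : ZMod 2} {T : 𝒜}

lemma foldLift_foldProj (w : ∀ i, T ⟶ P.X i) {i : ℕ} (hi : i ≤ n) (hj : (i : ZMod 2) = j) :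
    foldLift P n j w ≫ foldProj P n j i hi hj = w i :=
  biproduct.lift_π _ _

lemma fold_hom_ext {x y : T ⟶ (fold P n).X j}
    (h : ∀ i hi hj, x ≫ foldProj P n j i hi hj = y ≫ foldProj P n j i hi hj) : x = y :=
  biproduct.hom_ext _ _ fun i => h (i.1 : ℕ) (Nat.le_of_lt_succ i.1.2) i.2

/-- At most one entry in each column of the matrix is nonzero. At the top index `n` the component `w
(n + 1)` is absent from the fold, which is harmless because `P.X (n + 1)` is zero. -/
lemma foldLift_d (hP : ∀ i, n < i → IsZero (P.X i)) (w : ∀ i, T ⟶ P.X i) {j' : ZMod 2}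
    (hjj : j + 1 = j') :
    foldLift P n j w ≫ (fold P n).d j j' =
      foldLift P n j' fun i => w (i + 1) ≫ P.d (i + 1) i := by
  refine fold_hom_ext fun i hi hj => ?_
  rw [foldLift_foldProj]
  change (biproduct.lift _ ≫ biproduct.matrix _) ≫ biproduct.π _ _ = _
  rw [Category.assoc, biproduct.matrix_π, biproduct.lift_desc]
  by_cases hi' : i + 1 ≤ n
  · rw [Finset.sum_eq_single ⟨⟨i + 1, Nat.lt_succ_of_le hi'⟩, by
      push_cast; rw [hj, ← hjj, zmod_two_add_one_add_one]⟩]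
    · rintro b _ hb
      rw [P.shape, comp_zero]
      intro h
      apply hb
      apply Subtype.ext
      apply Fin.ext
      exact h.symm
    · simp
  · rw [Finset.sum_eq_zero, (hP (i + 1) (by omega)).eq_of_src (P.d (i + 1) i) 0, comp_zero]
    rintro b _
    rw [P.shape, comp_zero]
    intro h
    have : i + 1 = b.1 := h
    omega

lemma exists_eq_foldLift (x : T ⟶ (fold P n).X j) :
    ∃ w : ∀ i, T ⟶ P.X i, x = foldLift P n j w ∧ ∀ i : ℕ, (i : ZMod 2) ≠ j → w i = 0 := by
  refine ⟨fun i => if h : i ≤ n ∧ (i : ZMod 2) = j then x ≫ foldProj P n j i h.1 h.2 else 0,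
    fold_hom_ext fun i hi hj => ?_, fun i hi => dif_neg fun h => hi h.2⟩
  rw [foldLift_foldProj, dif_pos ⟨hi, hj⟩]

end

/-- The homology of the fold in degree 0 is the sum of the even homology of the resolution, of which
only H₀ ≅ M is nonzero. The isomorphism comes from projecting to P_0 and augmenting. -/
lemma nonempty_homology_fold_iso [EnoughProjectives 𝒜] {M : 𝒜} (P : FiniteResolution M) :
    Nonempty ((fold P.complex P.length).homology 0 ≅ M) := by
  let ε : P.complex.X 0 ⟶ M := P.π.f 0
  have hε : Epi ε := inferInstanceAs (Epi (P.π.f 0))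
  have hdε : P.complex.d 1 0 ≫ ε = 0 := P.complex_d_comp_π_f_zero
  have hex : (ShortComplex.mk _ _ hdε).Exact := P.exact₀
  have h₁₀ : (1 : ZMod 2) + 1 = 0 := rfl
  have h₀₁ : (0 : ZMod 2) + 1 = 1 := rfl
  have hp {T : 𝒜} (w : ∀ i, T ⟶ P.complex.X i) : foldLift P.complex P.length 0 w ≫
      foldProj P.complex P.length 0 0 (Nat.zero_le _) rfl ≫ ε = w 0 ≫ ε := by
    rw [← Category.assoc, foldLift_foldProj]
  refine nonempty_homology_zero_iso _
    (foldProj P.complex P.length 0 0 (Nat.zero_le _) rfl ≫ ε) ?_ ?_ ?_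
  · obtain ⟨w, hw, -⟩ := exists_eq_foldLift (𝟙 ((fold P.complex P.length).X 1))
    rw [← Category.id_comp ((fold P.complex P.length).d 1 0), hw, foldLift_d P.isZero_of_gt _ h₁₀,
      hp, Category.assoc, hdε, comp_zero]
  · intro T y
    obtain ⟨T', e, he, x, hx⟩ := surjective_up_to_refinements_of_epi ε y
    let w : ∀ i, T' ⟶ P.complex.X i := fun i => match i with
      | 0 => x
      | _ + 1 => 0
    refine ⟨T', e, he, foldLift P.complex P.length 0 w, ?_, (hp w).symm ▸ hx⟩
    rw [foldLift_d P.isZero_of_gt _ h₀₁]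
    refine fold_hom_ext fun i hi hj => ?_
    rw [foldLift_foldProj, zero_comp]
    simp
  · intro T x hx hxπ
    obtain ⟨w, rfl, hw⟩ := exists_eq_foldLift x
    rw [hp] at hxπ
    rw [foldLift_d P.isZero_of_gt _ h₀₁] at hx
    -- The cycle condition covers odd `i` up to the length; otherwise `w (i + 1)` vanishes by parity
    -- or `P_{i+1}` is zero.
    have hw₁ (i : ℕ) : w (i + 1) ≫ P.complex.d (i + 1) i = 0 := by
      by_cases hi : i ≤ P.length
      · by_cases hi' : (i : ZMod 2) = 1
        · rw [← foldLift_foldProj (fun i => w (i + 1) ≫ P.complex.d (i + 1) i) hi hi', hx,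
            zero_comp]
        · rw [hw (i + 1), zero_comp]
          intro h
          apply hi'
          push_cast at h
          rw [← zmod_two_add_one_add_one (i : ZMod 2), h, zero_add]
      · rw [(P.isZero_of_gt (i + 1) (by omega)).eq_of_src (P.complex.d _ _) 0, comp_zero]
    -- A projective cover of the test object lifts all components at once.
    let e := Projective.π T
    have hz (i : ℕ) : ∃ z : Projective.over T ⟶ P.complex.X (i + 1),
        z ≫ P.complex.d (i + 1) i = e ≫ w i := by
      cases i with
      | zero =>
        exact ⟨hex.liftFromProjective (e ≫ w 0) (by simp [hxπ]),
          hex.liftFromProjective_comp _ _⟩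
      | succ i =>
        exact ⟨(P.exact_succ i).liftFromProjective (e ≫ w (i + 1)) (by simp [hw₁]),
          (P.exact_succ i).liftFromProjective_comp _ _⟩
    choose z hz using hz
    let z' : ∀ i, Projective.over T ⟶ P.complex.X i := fun i => match i with
      | 0 => 0
      | i + 1 => z i
    refine ⟨_, e, inferInstance, foldLift P.complex P.length 1 z', ?_⟩
    rw [foldLift_d P.isZero_of_gt _ h₁₀]
    refine fold_hom_ext fun i hi hj => ?_
    rw [Category.assoc, foldLift_foldProj, foldLift_foldProj]
    exact (hz i).symm

end Fold

/-! ### Existence of finite projective resolutions -/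

section Resolutions

variable {𝒜 : Type u} [Category.{v} 𝒜] [Abelian 𝒜]

/-- An exact complex of projectives with an augmentation is a projective resolution. -/
def projectiveResolutionMk {M : 𝒜} (C : ChainComplex 𝒜 ℕ) (hC : ∀ n, Projective (C.X n))
    (p : C.X 0 ⟶ M) (hp : Epi p) (w : C.d 1 0 ≫ p = 0) (h₀ : (ShortComplex.mk _ _ w).Exact)
    (h : ∀ n, (ShortComplex.mk (C.d (n + 2) (n + 1)) (C.d (n + 1) n) (by simp)).Exact) :
    ProjectiveResolution M where
  complex := C
  projective := hC
  π := (ChainComplex.toSingle₀Equiv _ _).symm ⟨p, w⟩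
  quasiIso := ⟨fun n => by
    cases n with
    | zero =>
      rw [ChainComplex.quasiIsoAt₀_iff, ShortComplex.quasiIso_iff_of_zeros']
      · refine (ShortComplex.exact_and_epi_g_iff_of_iso ?_).2 ⟨h₀, hp⟩
        exact ShortComplex.isoMk (Iso.refl _) (Iso.refl _) (Iso.refl _)
          ((Category.id_comp _).trans (Category.comp_id _).symm)
          (by
            dsimp
            erw [Category.id_comp, Category.comp_id]
            exact (ChainComplex.toSingle₀Equiv_symm_apply_f_zero _ _).symm)
      all_goals first | rfl | exact C.shape 0 0 (by simp)
    | succ n =>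
      rw [quasiIsoAt_iff_exactAt' _ _ (ChainComplex.exactAt_succ_single_obj _ _),
        HomologicalComplex.exactAt_iff' _ (n + 2) (n + 1) n (by simp) (by simp)]
      exact h n⟩

/-- The resolution of `S.X₁` is spliced with `S.X₂` placed in degree 0, which raises the length by
one. -/
lemma nonempty_finiteResolution_of_shortExact {S : ShortComplex 𝒜} (hS : S.ShortExact)
    [Projective S.X₂] (Q : FiniteResolution S.X₁) : Nonempty (FiniteResolution S.X₃) := by
  have := hS.mono_f
  let ε : Q.complex.X 0 ⟶ S.X₁ := Q.π.f 0
  have hε : Epi ε := inferInstanceAs (Epi (Q.π.f 0))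
  have wε : Q.complex.d 1 0 ≫ ε = 0 := Q.complex_d_comp_π_f_zero
  have hex : (ShortComplex.mk _ _ wε).Exact := Q.exact₀
  have w : Q.complex.d 1 0 ≫ ε ≫ S.f = 0 := by rw [reassoc_of% wε, zero_comp]
  have w' : (ε ≫ S.f) ≫ S.g = 0 := by simp
  have hex₀ : (ShortComplex.mk _ _ w').Exact := by
    rw [ShortComplex.exact_iff_exact_up_to_refinements]
    intro T x hx
    obtain ⟨T', e, he, y, hy⟩ := surjective_up_to_refinements_of_epi ε (hS.exact.lift x hx)
    refine ⟨T', e, he, y, ?_⟩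
    have := hy =≫ S.f
    rwa [Category.assoc, hS.exact.lift_f, Category.assoc] at this
  let C := ChainComplex.augment Q.complex (ε ≫ S.f) w
  refine ⟨{ toProjectiveResolution := projectiveResolutionMk C ?_ S.g hS.epi_g ?_ ?_ ?_
            length := Q.length + 1
            isZero_of_gt := ?_ }⟩
  · rintro (_ | n)
    · exact ‹Projective S.X₂›
    · exact Q.projective n
  · exact w'
  · exact hex₀
  · rintro (_ | n)
    · rw [ShortComplex.exact_iff_exact_up_to_refinements]
      intro T x hx
      refine hex.exact_up_to_refinements x ?_
      rw [← cancel_mono S.f]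
      exact (Category.assoc _ _ _).trans (hx.trans zero_comp.symm)
    · exact Q.exact_succ n
  · rintro (_ | n) hn
    · omega
    · exact Q.isZero_of_gt n (by omega)

lemma nonempty_finiteResolution_of_projective (M : 𝒜) [Projective M] :
    Nonempty (FiniteResolution M) :=
  ⟨{ toProjectiveResolution := ProjectiveResolution.self M
     length := 0
     isZero_of_gt := fun _ hi => HomologicalComplex.isZero_single_obj_X _ _ _ _ hi.ne' }⟩

/-- The kernel of a projective cover has smaller projective dimension; its resolution is spliced
with the cover. -/
lemma nonempty_finiteResolution_of_hasProjectiveDimensionLE [EnoughProjectives 𝒜] (n : ℕ) (M : 𝒜)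
    (hM : HasProjectiveDimensionLE M n) : Nonempty (FiniteResolution M) := by
  induction n generalizing M with
  | zero =>
    have := projective_iff_hasProjectiveDimensionLE_zero M |>.2 hM
    exact nonempty_finiteResolution_of_projective M
  | succ n ih =>
    let S := ShortComplex.mk (kernel.ι (Projective.π M)) (Projective.π M) (kernel.condition _)
    have hS : S.ShortExact :=
      { exact := ShortComplex.exact_kernel _
        mono_f := inferInstanceAs (Mono (kernel.ι _))
        epi_g := inferInstanceAs (Epi (Projective.π M)) }
    have hP : Projective S.X₂ := Projective.projective_over M
    obtain ⟨Q⟩ := ih S.X₁ (hS.hasProjectiveDimensionLT_X₃_iff n hP |>.1 hM)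
    exact nonempty_finiteResolution_of_shortExact hS Q

end Resolutions

end BridgelandHall

end

/-! ### The main theorem -/

open CategoryTheory BridgelandHall in
theorem proposition3p6 {k : Type*} [Field k] [Finite k]
    {𝒜 : Type*} [Category 𝒜] [Abelian 𝒜] [Linear k 𝒜] [EnoughProjectives 𝒜]
    (hgl : HasFiniteGlobalDimension 𝒜) (hfin : IsFinitary k 𝒜) :
    (∀ M : 𝒜, Nonempty (FiniteResolution M)) ∧
    ∀ R : ∀ M : 𝒜, FiniteResolution M,
      Function.Injective (phi k R) ∧
      LinearIndependent ℂ (fun c : IsoClass 𝒜 => (R c.out).elemE k) := by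
  have := hfin.finite_homs
  obtain ⟨d, hd⟩ := id hgl
  refine ⟨fun M => nonempty_finiteResolution_of_hasProjectiveDimensionLE d M (hd M), fun R => ?_⟩
  have h := linearIndependent_elemE k hgl R fun M => nonempty_homology_fold_iso (R M)
  exact ⟨phi_injective k h, h⟩
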